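/- Consider the word RAM with $w$-bit words: a fixed finite program works on registers and on a memory of words, and each arithmetic operation ($+,-,\cdot$ modulo $2^w$, integer division and remainder), bitwise operation, shift, comparison, memory access and branch takes unit time. For every constant $c$ there are query programs and constants $A,B$, all depending only on $c$, such that the following holds for every integer $n\ge 3$ and every word size $w$ with $2^w\ge A n$ (that is, $w\ge\log_2 n+O(1)$). Let $S$ be a set of at most $cn$ points $(x',y')$ with integer coordinates and $1\le y'\le x'\le n$, i.e. on or below the main diagonal of the $n\times n$ integer grid. Then there is a data structure for $S$ that occupies at most $An$ words of memory and on which the query programs answer every dominance counting query: given a point $(x,y)\in\{1,\dots,n\}^2$ and a choice of one of the four closed axis-parallel quadrants with apex $(x,y)$ (for instance $\{(x',y') : x'\le x,\ y'\ge y\}$), the program for this kind of quadrant returns the number of points of $S$ in the quadrant, leaves the data structure unchanged, and takes time at most $$B\left(1+\frac{\log d}{\log\log n}\right),\qquad d=|x-y|,$$ where $\log d$ is read as $0$ for $d=0$. (Here $d$ is $\sqrt2$ times the Euclidean distance of the query point from the main diagonal.) In short: linear space and query time $O(1+\log d/\log\log n)$. -/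

import Mathlib

namespace WordRAM

/-- The unit-cost binary operations on `w`-bit words. -/
inductive BinOp where
  | add | sub | mul | div | mod
  | and | or | xor | shl | shr
  | lt | eq

/-- Arithmetic is unsigned and modulo `2 ^ w`, division rounds down, comparisons return the word
`1` (true) or `0` (false). -/
def BinOp.apply {w : ℕ} : BinOp → BitVec w → BitVec w → BitVec w
  | .add, a, b => a + b
  | .sub, a, b => a - b
  | .mul, a, b => a * b
  | .div, a, b => a / b
  | .mod, a, b => a % b
  | .and, a, b => a &&& b
  | .or, a, b => a ||| b
  | .xor, a, b => a ^^^ b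
  | .shl, a, b => a <<< b
  | .shr, a, b => a >>> b
  | .lt, a, b => if a.toNat < b.toNat then BitVec.ofNat w 1 else BitVec.ofNat w 0
  | .eq, a, b => if a.toNat = b.toNat then BitVec.ofNat w 1 else BitVec.ofNat w 0

/-- A configuration of the machine with word size `w`: registers, each holding one word, and a
memory, a finite array of words. A program mentions only finitely many registers. -/
structure State (w : ℕ) where
  reg : ℕ → BitVec w
  mem : List (BitVec w)

/-- Expressions: literals, registers, binary operations, and reading the memory cell whose address
is the value of a subexpression. The expressions do not depend on the word size. -/
inductive Expr where
  | lit (k : ℕ)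
  | reg (r : ℕ)
  | bin (o : BinOp) (a b : Expr)
  | load (a : Expr)

/-- The value of an expression; undefined (`none`) if it reads outside the memory. -/
def Expr.eval {w : ℕ} (s : State w) : Expr → Option (BitVec w)
  | .lit k => some (BitVec.ofNat w k)
  | .reg r => some (s.reg r)
  | .bin o a b => (a.eval s).bind fun u => (b.eval s).bind fun v => some (o.apply u v)
  | .load a => (a.eval s).bind fun u => s.mem[u.toNat]?

/-- The time to evaluate an expression: one unit for every literal, register access, operation and
memory access. -/
def Expr.cost : Expr → ℕ
  | .lit _ => 1
  | .reg _ => 1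
  | .bin _ a b => a.cost + b.cost + 1
  | .load a => a.cost + 1

/-- Programs. They are finite objects that do not depend on the word size or on the input. -/
inductive Prog where
  | skip
  | assign (r : ℕ) (e : Expr)
  | store (addr val : Expr)
  | seq (p q : Prog)
  | ite (e : Expr) (p q : Prog)
  | loop (e : Expr) (p : Prog)

/-- `Exec p s t s'`: the program `p`, started in `s`, halts in `s'` after exactly `t` time units.
A read or write outside the memory aborts the run (no rule applies). The branch `ite e p q` runs
`p` if `e` is nonzero and `q` otherwise; `loop e p` repeats `p` while `e` is nonzero. -/
inductive Exec {w : ℕ} : Prog → State w → ℕ → State w → Prop where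
  | skip (s : State w) : Exec .skip s 1 s
  | assign (r : ℕ) (e : Expr) (s : State w) (v : BitVec w) (he : e.eval s = some v) :
      Exec (.assign r e) s (e.cost + 1) { s with reg := Function.update s.reg r v }
  | store (addr val : Expr) (s : State w) (u v : BitVec w) (hu : addr.eval s = some u)
      (hv : val.eval s = some v) (hlt : u.toNat < s.mem.length) :
      Exec (.store addr val) s (addr.cost + val.cost + 1) { s with mem := s.mem.set u.toNat v }
  | seq (p q : Prog) (s₁ s₂ s₃ : State w) (t₁ t₂ : ℕ) (hp : Exec p s₁ t₁ s₂)
      (hq : Exec q s₂ t₂ s₃) : Exec (.seq p q) s₁ (t₁ + t₂) s₃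
  | ite_true (e : Expr) (p q : Prog) (s s' : State w) (v : BitVec w) (t : ℕ)
      (he : e.eval s = some v) (hv : v.toNat ≠ 0) (hp : Exec p s t s') :
      Exec (.ite e p q) s (e.cost + 1 + t) s'
  | ite_false (e : Expr) (p q : Prog) (s s' : State w) (v : BitVec w) (t : ℕ)
      (he : e.eval s = some v) (hv : v.toNat = 0) (hq : Exec q s t s') :
      Exec (.ite e p q) s (e.cost + 1 + t) s'
  | loop_done (e : Expr) (p : Prog) (s : State w) (v : BitVec w) (he : e.eval s = some v)
      (hv : v.toNat = 0) : Exec (.loop e p) s (e.cost + 1) s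
  | loop_step (e : Expr) (p : Prog) (s₁ s₂ s₃ : State w) (v : BitVec w) (t₁ t₂ : ℕ)
      (he : e.eval s₁ = some v) (hv : v.toNat ≠ 0) (hp : Exec p s₁ t₁ s₂)
      (hl : Exec (.loop e p) s₂ t₂ s₃) : Exec (.loop e p) s₁ (e.cost + 1 + t₁ + t₂) s₃

/-- The start of a query `(x, y)`: the memory holds the data structure, registers `0` and `1` hold
`x` and `y`, and all other registers are zero. -/
def queryState {w : ℕ} (mem : List (BitVec w)) (x y : ℕ) : State w where
  reg := fun r => if r = 0 then BitVec.ofNat w x else if r = 1 then BitVec.ofNat w y else 0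
  mem := mem

end WordRAM

/-- The four closed axis-parallel quadrants with a given apex. -/
inductive Quadrant where
  | leLe | leGe | geLe | geGe

/-- The number of points of `S` in the quadrant of the given kind with apex `(x, y)`. -/
def dominanceCount (S : Finset (ℕ × ℕ)) (x y : ℕ) : Quadrant → ℕ
  | .leLe => (S.filter fun p => p.1 ≤ x ∧ p.2 ≤ y).card
  | .leGe => (S.filter fun p => p.1 ≤ x ∧ y ≤ p.2).card
  | .geLe => (S.filter fun p => x ≤ p.1 ∧ p.2 ≤ y).card
  | .geGe => (S.filter fun p => x ≤ p.1 ∧ y ≤ p.2).card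

/-- `S` lies in the grid `{1, …, n} × {1, …, n}`, on or below the main diagonal. -/
def BelowDiagonal (n : ℕ) (S : Finset (ℕ × ℕ)) : Prop :=
  ∀ p ∈ S, 1 ≤ p.2 ∧ p.2 ≤ p.1 ∧ p.1 ≤ n

/-! Only the quadrant `p.1 ≤ x`, `y ≤ p.2` needs work; the other three follow by inclusion and
exclusion with prefix counts of rows and columns. A point on or below the diagonal in this quadrant
satisfies `y ≤ p.2 ≤ p.1 ≤ x`. There is none if `x < y`; otherwise all lie in the `d + 1` rows from
`y` to `x`. Let `d + 1 < K`. Of two families of blocks of `2 * K` rows, shifted against each other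
by `K`, one has a block containing all these rows, and there `p.1 ≤ x` becomes a bound on the offset
of `p.1` from the start of the block, a number below `2 * K` (`blockKey_lt_iff`). It remains to
count, in the list of points ordered by rows, the entries of an interval of positions whose key is
below a bound `v`, for keys of `O(1 + log d)` bits.

This is done by a stable radix sort in a base `f` of order `(log n) ^ (1/4)` (a wavelet matrix).
Entries of the interval with a leading digit below that of `v` are counted at once; those with an
equal digit form an interval of the next list, by stability (`countP_take_sub`). Every digit thus
costs a constant number of rank queries on a digit sequence, and `O(1 + log d / log log n)` digits
suffice (`digitsFor_le_log`). A rank query takes constant time: an absolute count, a packed relative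
count and a table lookup (`Index.rank_split`, `Index.Fits.ev_rank`).

For linear space, only depths that are powers of two, or the maximal depth, are stored. The numbers
of digits form a geometric sum, so there are `O(log n / log log n)` sequences, each of `O(n log log
n / log n)` words for fixed `c` (`dominanceIndex_fits`). -/

namespace WordRAM

/-! ### Values of expressions and running times of programs, in terms of natural numbers -/

/-- The state `s` has memory `μ` and register values `ρ`. -/
def Rep {w : ℕ} (μ : List (BitVec w)) (ρ : ℕ → ℕ) (s : State w) : Prop :=
  s.mem = μ ∧ ∀ r, (s.reg r).toNat = ρ r

/-- The expression `e` has value `v` when the memory is `μ` and the registers hold `ρ`. -/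
def Ev {w : ℕ} (μ : List (BitVec w)) (ρ : ℕ → ℕ) (e : Expr) (v : ℕ) : Prop :=
  ∀ s : State w, Rep μ ρ s → ∃ u : BitVec w, e.eval s = some u ∧ u.toNat = v

section Ev

variable {w : ℕ} {μ : List (BitVec w)} {ρ : ℕ → ℕ} {a b e : Expr} {u v : ℕ}

theorem Ev.lit (k : ℕ) (hk : k < 2 ^ w) : Ev μ ρ (.lit k) k := fun s _ =>
  ⟨BitVec.ofNat w k, rfl, by simp [Nat.mod_eq_of_lt hk]⟩

theorem Ev.reg (r : ℕ) : Ev μ ρ (.reg r) (ρ r) := fun s hs => ⟨s.reg r, rfl, hs.2 r⟩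

theorem Ev.reg_of_eq {r : ℕ} (h : ρ r = v) : Ev μ ρ (.reg r) v := h ▸ Ev.reg r

theorem Ev.bin {o : BinOp} {z : ℕ} (ha : Ev μ ρ a u) (hb : Ev μ ρ b v)
    (h : ∀ x y : BitVec w, x.toNat = u → y.toNat = v → (o.apply x y).toNat = z) :
    Ev μ ρ (.bin o a b) z := fun s hs => by
  obtain ⟨x, hx, hx'⟩ := ha s hs
  obtain ⟨y, hy, hy'⟩ := hb s hs
  exact ⟨o.apply x y, by simp [Expr.eval, hx, hy], h x y hx' hy'⟩

theorem Ev.add (ha : Ev μ ρ a u) (hb : Ev μ ρ b v) (h : u + v < 2 ^ w) :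
    Ev μ ρ (.bin .add a b) (u + v) :=
  ha.bin hb fun x y hx hy => by simp [BinOp.apply, hx, hy, Nat.mod_eq_of_lt h]

theorem Ev.mul (ha : Ev μ ρ a u) (hb : Ev μ ρ b v) (h : u * v < 2 ^ w) :
    Ev μ ρ (.bin .mul a b) (u * v) :=
  ha.bin hb fun x y hx hy => by simp [BinOp.apply, hx, hy, Nat.mod_eq_of_lt h]

theorem Ev.sub (ha : Ev μ ρ a u) (hb : Ev μ ρ b v) (h : v ≤ u) :
    Ev μ ρ (.bin .sub a b) (u - v) :=
  ha.bin hb fun x y hx hy => by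
    have : y ≤ x := by rw [BitVec.le_def]; omega
    simp [BinOp.apply, BitVec.toNat_sub_of_le this, hx, hy]

theorem Ev.div (ha : Ev μ ρ a u) (hb : Ev μ ρ b v) : Ev μ ρ (.bin .div a b) (u / v) :=
  ha.bin hb fun x y hx hy => by simp [BinOp.apply, hx, hy]

theorem Ev.mod (ha : Ev μ ρ a u) (hb : Ev μ ρ b v) : Ev μ ρ (.bin .mod a b) (u % v) :=
  ha.bin hb fun x y hx hy => by simp [BinOp.apply, hx, hy]

theorem Ev.lt (ha : Ev μ ρ a u) (hb : Ev μ ρ b v) (hw : 1 < 2 ^ w) :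
    Ev μ ρ (.bin .lt a b) (if u < v then 1 else 0) :=
  ha.bin hb fun x y hx hy => by
    simp only [BinOp.apply, hx, hy]
    split <;> simp [Nat.mod_eq_of_lt hw]

theorem Ev.load {z : BitVec w} (ha : Ev μ ρ a u) (h : μ[u]? = some z) :
    Ev μ ρ (.load a) z.toNat := fun s hs => by
  obtain ⟨x, hx, hx'⟩ := ha s hs
  refine ⟨z, ?_, rfl⟩
  simp [Expr.eval, hx, hx', hs.1, h]

theorem Ev.of_eq (h : Ev μ ρ e u) (huv : u = v) : Ev μ ρ e v := huv ▸ h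

/-- The expression `a * b + e`, the index of an entry in an array of rows. -/
theorem Ev.mulAdd {z : ℕ} (ha : Ev μ ρ a u) (hb : Ev μ ρ b v) (he : Ev μ ρ e z)
    (h : u * v + z < 2 ^ w) : Ev μ ρ (.bin .add (.bin .mul a b) e) (u * v + z) :=
  (ha.mul hb (by omega)).add he h

end Ev

/-- The program `p` halts within `t` steps, turns the register values `ρ` into `ρ'`, and leaves the
memory `μ` unchanged. -/
def Runs {w : ℕ} (μ : List (BitVec w)) (p : Prog) (ρ : ℕ → ℕ) (t : ℕ) (ρ' : ℕ → ℕ) : Prop :=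
  ∀ s : State w, Rep μ ρ s → ∃ t' s', Exec p s t' s' ∧ t' ≤ t ∧ Rep μ ρ' s'

section Runs

variable {w : ℕ} {μ : List (BitVec w)} {ρ ρ' ρ'' : ℕ → ℕ} {p q : Prog} {e : Expr} {v t t' : ℕ}

theorem Runs.assign (r : ℕ) (he : Ev μ ρ e v) :
    Runs μ (.assign r e) ρ (e.cost + 1) (Function.update ρ r v) := fun s hs => by
  obtain ⟨x, hx, hx'⟩ := he s hs
  refine ⟨_, _, Exec.assign r e s x hx, le_rfl, hs.1, fun r' => ?_⟩
  by_cases h : r' = r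
  · subst h; simp [hx']
  · simp [h, hs.2 r']

theorem Runs.seq (hp : Runs μ p ρ t ρ') (hq : Runs μ q ρ' t' ρ'') :
    Runs μ (.seq p q) ρ (t + t') ρ'' := fun s hs => by
  obtain ⟨t₁, s₁, h₁, ht₁, hs₁⟩ := hp s hs
  obtain ⟨t₂, s₂, h₂, ht₂, hs₂⟩ := hq s₁ hs₁
  exact ⟨_, _, Exec.seq _ _ _ _ _ _ _ h₁ h₂, by omega, hs₂⟩

theorem Runs.ite_true (he : Ev μ ρ e v) (hv : v ≠ 0) (hp : Runs μ p ρ t ρ') :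
    Runs μ (.ite e p q) ρ (e.cost + 1 + t) ρ' := fun s hs => by
  obtain ⟨x, hx, hx'⟩ := he s hs
  obtain ⟨t₁, s₁, h₁, ht₁, hs₁⟩ := hp s hs
  exact ⟨_, _, Exec.ite_true _ _ _ _ _ x _ hx (by omega) h₁, by omega, hs₁⟩

theorem Runs.ite_false (he : Ev μ ρ e v) (hv : v = 0) (hq : Runs μ q ρ t ρ') :
    Runs μ (.ite e p q) ρ (e.cost + 1 + t) ρ' := fun s hs => by
  obtain ⟨x, hx, hx'⟩ := he s hs
  obtain ⟨t₁, s₁, h₁, ht₁, hs₁⟩ := hq s hs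
  exact ⟨_, _, Exec.ite_false _ _ _ _ _ x _ hx (by omega) h₁, by omega, hs₁⟩

theorem Runs.loop_done (he : Ev μ ρ e v) (hv : v = 0) :
    Runs μ (.loop e p) ρ (e.cost + 1) ρ := fun s hs => by
  obtain ⟨x, hx, hx'⟩ := he s hs
  exact ⟨_, _, Exec.loop_done _ _ _ x hx (by omega), le_rfl, hs⟩

theorem Runs.loop_step (he : Ev μ ρ e v) (hv : v ≠ 0) (hp : Runs μ p ρ t ρ')
    (hl : Runs μ (.loop e p) ρ' t' ρ'') :
    Runs μ (.loop e p) ρ (e.cost + 1 + t + t') ρ'' := fun s hs => by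
  obtain ⟨x, hx, hx'⟩ := he s hs
  obtain ⟨t₁, s₁, h₁, ht₁, hs₁⟩ := hp s hs
  obtain ⟨t₂, s₂, h₂, ht₂, hs₂⟩ := hl s₁ hs₁
  exact ⟨_, _, Exec.loop_step _ _ _ _ _ x _ _ hx (by omega) h₁ h₂, by omega, hs₂⟩

theorem Runs.mono (h : Runs μ p ρ t ρ') (ht : t ≤ t') : Runs μ p ρ t' ρ' := fun s hs => by
  obtain ⟨t₁, s₁, h₁, ht₁, hs₁⟩ := h s hs
  exact ⟨t₁, s₁, h₁, ht₁.trans ht, hs₁⟩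

end Runs

/-! ### Arrays in memory -/

/-- The memory that interleaves sixteen arrays `R 0, …, R 15` of length `Z`: the cell `16 * j + r`
holds `R r j`. -/
def interleave (w Z : ℕ) (R : ℕ → ℕ → ℕ) : List (BitVec w) :=
  (List.range (16 * Z)).map fun i => BitVec.ofNat w (R (i % 16) (i / 16))

theorem length_interleave (w Z : ℕ) (R : ℕ → ℕ → ℕ) : (interleave w Z R).length = 16 * Z := by
  simp [interleave]

/-- Entry number `e` of the array `r` of an interleaved memory. -/
def cell (r : ℕ) (e : Expr) : Expr :=
  .load (.bin .add (.bin .mul (.lit 16) e) (.lit r))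

/-- The condition `32 * Z ≤ 2 ^ w` ensures that the address `16 * j + r < 16 * Z` is computed
without wrapping around. -/
theorem Ev.cell {w Z : ℕ} {R : ℕ → ℕ → ℕ} {ρ : ℕ → ℕ} {e : Expr} {j : ℕ}
    (he : Ev (interleave w Z R) ρ e j) (r : ℕ) (hr : r < 16) (hj : j < Z) (hZ : 32 * Z ≤ 2 ^ w)
    (hR : R r j < 2 ^ w) : Ev (interleave w Z R) ρ (cell r e) (R r j) := by
  have h := (((Ev.lit 16 (by omega)).mulAdd he (Ev.lit r (by omega)) (by omega)).load
    (z := BitVec.ofNat w (R r j)) ?_)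
  · simpa [WordRAM.cell, Nat.mod_eq_of_lt hR] using h
  · have h1 : (16 * j + r) % 16 = r := by omega
    have h2 : (16 * j + r) / 16 = j := by omega
    have h3 : 16 * j + r < 16 * Z := by omega
    simp [interleave, h1, h2, List.getElem?_range h3]

end WordRAM

/-! ### Packed digits and ranks in digit sequences -/

/-- The word that holds the `m` digits `h (i * m), …, h (i * m + m - 1)` in base `B`. -/
def pack (B m : ℕ) (h : ℕ → ℕ) (i : ℕ) : ℕ :=
  ∑ j ∈ Finset.range m, h (i * m + j) * B ^ j

theorem sum_digits_lt {B : ℕ} {h : ℕ → ℕ} (hh : ∀ i, h i < B) (m : ℕ) :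
    ∑ j ∈ Finset.range m, h j * B ^ j < B ^ m := by
  induction m with
  | zero => simp
  | succ m ih =>
    rw [Finset.sum_range_succ, pow_succ]
    have : (h m + 1) * B ^ m ≤ B * B ^ m := Nat.mul_le_mul_right _ (hh m)
    nlinarith

theorem sum_digits_div_mod {B : ℕ} {h : ℕ → ℕ} (hh : ∀ i, h i < B) {m i : ℕ} (hi : i < m) :
    (∑ j ∈ Finset.range m, h j * B ^ j) / B ^ i % B = h i := by
  have hB : 0 < B := (Nat.zero_le _).trans_lt (hh 0)
  obtain ⟨k, rfl⟩ := Nat.exists_eq_add_of_lt hi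
  have h1 : ∑ j ∈ Finset.range (i + k + 1), h j * B ^ j =
      ∑ j ∈ Finset.range i, h j * B ^ j +
        B ^ i * (h i + B * ∑ j ∈ Finset.range k, h (i + 1 + j) * B ^ j) := by
    rw [show i + k + 1 = (i + 1) + k by omega, Finset.sum_range_add, Finset.sum_range_succ,
      add_assoc, mul_add, Finset.mul_sum, Finset.mul_sum]
    congr 2
    · ring
    · exact Finset.sum_congr rfl fun j _ => by ring
  rw [h1, Nat.add_mul_div_left _ _ (pow_pos hB i), Nat.div_eq_of_lt (sum_digits_lt hh i), zero_add,
    Nat.add_mul_mod_self_left, Nat.mod_eq_of_lt (hh i)]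

theorem pack_lt {B : ℕ} {h : ℕ → ℕ} (hh : ∀ i, h i < B) (m i : ℕ) : pack B m h i < B ^ m :=
  sum_digits_lt (fun j => hh (i * m + j)) m

theorem pack_div_mod {B : ℕ} {h : ℕ → ℕ} (hh : ∀ i, h i < B) {m j : ℕ} (i : ℕ) (hj : j < m) :
    pack B m h i / B ^ j % B = h (i * m + j) :=
  sum_digits_div_mod (fun j => hh (i * m + j)) hj

/-- The number of positions before `p` with a digit smaller than `a`. -/
def rankLt (δ : ℕ → ℕ) (a p : ℕ) : ℕ := Nat.count (fun i => δ i < a) p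

theorem rankLt_le (δ : ℕ → ℕ) (a p : ℕ) : rankLt δ a p ≤ p := Nat.count_le _

theorem rankLt_add (δ : ℕ → ℕ) (a p q : ℕ) :
    rankLt δ a (p + q) = rankLt δ a p + rankLt (fun i => δ (p + i)) a q := by
  simp only [rankLt]
  rw [Nat.count_add]

theorem rankLt_mono_right (δ : ℕ → ℕ) (a : ℕ) {p q : ℕ} (h : p ≤ q) :
    rankLt δ a p ≤ rankLt δ a q := Nat.count_monotone _ h

theorem rankLt_mono_left (δ : ℕ → ℕ) {a b : ℕ} (p : ℕ) (h : a ≤ b) :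
    rankLt δ a p ≤ rankLt δ b p := Nat.count_mono_left fun _ _ hk => hk.trans_le h

theorem rankLt_congr {δ δ' : ℕ → ℕ} (a : ℕ) {p : ℕ} (h : ∀ i < p, δ i = δ' i) :
    rankLt δ a p = rankLt δ' a p := by
  induction p with
  | zero => simp [rankLt]
  | succ p ih =>
    have := ih fun i hi => h i (by omega)
    simp only [rankLt, Nat.count_succ] at this ⊢
    rw [this, h p (by omega)]

/-! ### Rank queries in constant time -/

/-- The contents of the dominance counting structure: `N` points, rank structures for the digit
sequences `dig t` in base `f`, stored in blocks of `s` digits with relative counts in base `V`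
packed in groups of `g`, the prefix counts `pos` and `cx`, and for every distance the parameters
`bk`, `start`, `depth`, `pw` of the digit sequences to be used. -/
structure Index where
  N : ℕ
  f : ℕ
  s : ℕ
  g : ℕ
  V : ℕ
  dig : ℕ → ℕ → ℕ
  pos : ℕ → ℕ
  cx : ℕ → ℕ
  bk : ℕ → ℕ
  start : ℕ → ℕ
  depth : ℕ → ℕ
  pw : ℕ → ℕ

namespace Index

variable (X : Index)

/-- The number of words of digits of one sequence. -/
def chunkLen : ℕ := X.N / X.s + 1

/-- The number of absolute counts of one sequence. -/
def absLen : ℕ := (X.N / (X.s * (X.f + 1)) + 1) * (X.f + 1)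

/-- The number of words of packed relative counts of one sequence. -/
def relLen : ℕ := X.chunkLen * (X.f + 1) / X.g + 1

/-- The number of digits smaller than `a` in a prefix of a packed block of digits. -/
def tableVal (i : ℕ) : ℕ :=
  rankLt (fun j => i / (X.f + 1) / X.s / X.f ^ j % X.f) (i % (X.f + 1)) (i / (X.f + 1) % X.s)

/-- Absolute counts at the multiples of `s * (f + 1)`. -/
def absVal (t i : ℕ) : ℕ :=
  rankLt (X.dig t) (i % (X.f + 1)) (X.s * (X.f + 1) * (i / (X.f + 1)))

/-- Counts at the multiples of `s`, relative to the preceding multiple of `s * (f + 1)`. -/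
def relVal (t i : ℕ) : ℕ :=
  rankLt (X.dig t) (i % (X.f + 1)) (X.s * (i / (X.f + 1))) -
    rankLt (X.dig t) (i % (X.f + 1)) (X.s * (X.f + 1) * (i / (X.f + 1) / (X.f + 1)))

/-- The arrays of the data structure. -/
def region : ℕ → ℕ → ℕ
  | 0, i => [X.N, X.f, X.s, X.s * (X.f + 1), X.V, X.g, X.chunkLen, X.absLen, X.relLen,
      X.f + 1].getD i 0
  | 1, i => X.pos i
  | 2, i => X.cx i
  | 3, i => X.bk i
  | 4, i => X.start i
  | 5, i => X.depth i
  | 6, i => X.pw i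
  | 7, i => X.tableVal i
  | 8, i => pack X.f X.s (X.dig (i / X.chunkLen)) (i % X.chunkLen)
  | 9, i => pack X.V X.g (X.relVal (i / X.relLen)) (i % X.relLen)
  | 10, i => X.absVal (i / X.absLen) (i % X.absLen)
  | 11, i => X.V ^ i
  | _, _ => 0

/-- The rank structures for `T` digit sequences fit into arrays of `Z` words of `w` bits. -/
structure Fits (w Z T : ℕ) : Prop where
  addr : 32 * Z ≤ 2 ^ w
  ten_le : 10 ≤ Z
  f_pos : 0 < X.f
  s_pos : 0 < X.s
  g_pos : 0 < X.g
  T_pos : 0 < T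
  lt_V : X.s * (X.f + 1) < X.V
  dig_lt : ∀ t i, X.dig t i < X.f
  N_le : X.N ≤ Z
  table_le : X.f ^ X.s * X.s * (X.f + 1) ≤ Z
  pow_le : X.V ^ X.g ≤ Z
  chunk_le : T * X.chunkLen ≤ Z
  cells_le : X.chunkLen * (X.f + 1) ≤ Z
  rel_le : T * X.relLen ≤ Z
  abs_le : T * X.absLen ≤ Z

/-- The expression for `rankLt (dig t) a p`. -/
def rankExpr (t a p : WordRAM.Expr) : WordRAM.Expr :=
  let con (i : ℕ) : WordRAM.Expr := WordRAM.cell 0 (.lit i)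
  let row (x y z : WordRAM.Expr) : WordRAM.Expr := .bin .add (.bin .mul x y) z
  let e : WordRAM.Expr := row (.bin .div p (con 2)) (con 9) a
  .bin .add
    (.bin .add
      (WordRAM.cell 10 (row t (con 7) (row (.bin .div p (con 3)) (con 9) a)))
      (.bin .mod (.bin .div (WordRAM.cell 9 (row t (con 8) (.bin .div e (con 5))))
        (WordRAM.cell 11 (.bin .mod e (con 5)))) (con 4)))
    (WordRAM.cell 7 (row (row (WordRAM.cell 8 (row t (con 6) (.bin .div p (con 2)))) (con 2)
      (.bin .mod p (con 2))) (con 9) a))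

variable {X}

theorem row_div {a b c : ℕ} (h : c < b) : (a * b + c) / b = a := by
  rw [mul_comm, Nat.mul_add_div (by omega), Nat.div_eq_of_lt h, add_zero]

theorem row_mod {a b c : ℕ} (h : c < b) : (a * b + c) % b = c := by
  rw [mul_comm, Nat.mul_add_mod, Nat.mod_eq_of_lt h]

theorem row_lt {a b c A : ℕ} (ha : a < A) (h : c < b) : a * b + c < A * b := by
  have : (a + 1) * b ≤ A * b := Nat.mul_le_mul_right _ ha
  nlinarith

/-- A relative count looks back over at most `f + 1` blocks of `s` digits, so it is a digit in base
`V` and can be packed. -/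
theorem relVal_lt (hV : X.s * (X.f + 1) < X.V) (t i : ℕ) :
    X.relVal t i < X.V := by
  refine lt_of_le_of_lt ?_ hV
  unfold relVal
  set q := i / (X.f + 1)
  have h1 : X.s * q = X.s * (X.f + 1) * (q / (X.f + 1)) + X.s * (q % (X.f + 1)) := by
    rw [mul_assoc, ← mul_add, Nat.div_add_mod]
  rw [h1, rankLt_add, Nat.add_sub_cancel_left]
  refine (rankLt_le _ _ _).trans ?_
  exact Nat.mul_le_mul_left _ (Nat.mod_lt _ (by omega)).le

/-- The decomposition of a rank into the absolute, the relative and the tabulated part. -/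
theorem rank_split {w Z T : ℕ} (hX : X.Fits w Z T) (t : ℕ) {a : ℕ} (ha : a ≤ X.f) (p : ℕ) :
    X.absVal t (p / (X.s * (X.f + 1)) * (X.f + 1) + a) +
      X.relVal t (p / X.s * (X.f + 1) + a) +
      X.tableVal ((pack X.f X.s (X.dig t) (p / X.s) * X.s + p % X.s) * (X.f + 1) + a) =
    rankLt (X.dig t) a p := by
  have hs := hX.s_pos
  have ha' : a < X.f + 1 := by omega
  simp only [absVal, relVal, tableVal, row_div ha', row_mod ha', row_div (Nat.mod_lt p hs),
    row_mod (Nat.mod_lt p hs)]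
  rw [← Nat.div_div_eq_div_mul]
  -- The absolute count is taken at an earlier position, so the truncated subtraction in `relVal` is
  -- exact.
  have h1 : X.s * (X.f + 1) * (p / X.s / (X.f + 1)) ≤ X.s * (p / X.s) := by
    rw [mul_assoc]; exact Nat.mul_le_mul_left _ (Nat.mul_div_le _ _)
  rw [Nat.add_sub_cancel' (rankLt_mono_right _ _ h1)]
  conv_rhs => rw [← Nat.div_add_mod p X.s, rankLt_add]
  congr 1
  refine rankLt_congr _ fun i hi => ?_
  rw [pack_div_mod (hX.dig_lt t) _ (hi.trans (Nat.mod_lt p hs)), mul_comm]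

open WordRAM in
-- The machine computes modulo `2 ^ w`, so every address and intermediate value has to be bounded;
-- all bounds come down to the array length `Z`.
theorem Fits.ev_rank {w Z T : ℕ} (hX : X.Fits w Z T) {ρ : ℕ → ℕ} {et ea ep : Expr} {t a p : ℕ}
    (ht : Ev (interleave w Z X.region) ρ et t) (ha : Ev (interleave w Z X.region) ρ ea a)
    (hp : Ev (interleave w Z X.region) ρ ep p) (htT : t < T) (haf : a ≤ X.f) (hpN : p ≤ X.N) :
    Ev (interleave w Z X.region) ρ (rankExpr et ea ep) (rankLt (X.dig t) a p) := by
  have hZ := hX.addr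
  have hten := hX.ten_le
  have hs := hX.s_pos
  have hf := hX.f_pos
  have hg := hX.g_pos
  have haf' : a < X.f + 1 := by omega
  have hfs : 0 < X.f ^ X.s := pow_pos hf _
  have hVg : X.V < 2 ^ w := by
    have : X.V ^ 1 ≤ X.V ^ X.g := Nat.pow_le_pow_right (by have := hX.lt_V; omega) hg
    rw [pow_one] at this
    have := hX.pow_le
    omega
  have hgZ : X.g ≤ Z := by
    have : X.g < X.V ^ X.g := Nat.lt_pow_self (by
      have := hX.lt_V
      have : 0 < X.s * (X.f + 1) := by positivity
      omega)
    have := hX.pow_le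
    omega
  have hS : X.s * (X.f + 1) ≤ Z := by
    refine le_trans ?_ hX.table_le
    rw [mul_assoc]
    exact Nat.le_mul_of_pos_left _ hfs
  have hS1 : X.s ≤ X.s * (X.f + 1) := Nat.le_mul_of_pos_right _ (by omega)
  have hS2 : X.f + 1 ≤ X.s * (X.f + 1) := Nat.le_mul_of_pos_left _ hs
  have hD1 : X.chunkLen ≤ Z := (Nat.le_mul_of_pos_left _ hX.T_pos).trans hX.chunk_le
  have hD2 : X.absLen ≤ Z := (Nat.le_mul_of_pos_left _ hX.T_pos).trans hX.abs_le
  have hD3 : X.relLen ≤ Z := (Nat.le_mul_of_pos_left _ hX.T_pos).trans hX.rel_le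
  have con (i v : ℕ) (hi : i < 10) (hv : X.region 0 i = v) (hb : v < 2 ^ w) :
      Ev (interleave w Z X.region) ρ (cell 0 (.lit i)) v :=
    ((Ev.lit i (by omega)).cell 0 (by omega) (by omega) hZ (by omega)).of_eq hv
  have c2 := con 2 X.s (by omega) rfl (by omega)
  have c3 := con 3 (X.s * (X.f + 1)) (by omega) rfl (by omega)
  have c4 := con 4 X.V (by omega) rfl (by omega)
  have c5 := con 5 X.g (by omega) rfl (by omega)
  have c6 := con 6 X.chunkLen (by omega) rfl (by omega)
  have c7 := con 7 X.absLen (by omega) rfl (by omega)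
  have c8 := con 8 X.relLen (by omega) rfl (by omega)
  have c9 := con 9 (X.f + 1) (by omega) rfl (by omega)
  have hq : p / X.s < X.chunkLen := Nat.lt_succ_of_le (Nat.div_le_div_right hpN)
  have hrel : ∀ i, X.relVal t i < X.V := relVal_lt hX.lt_V t
  -- absolute counts
  have hA0 : p / (X.s * (X.f + 1)) * (X.f + 1) + a < X.absLen :=
    row_lt (Nat.lt_succ_of_le (Nat.div_le_div_right hpN)) haf'
  have hA1 := (row_lt htT hA0).trans_le hX.abs_le
  have hAv : X.region 10 (t * X.absLen + (p / (X.s * (X.f + 1)) * (X.f + 1) + a)) =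
      X.absVal t (p / (X.s * (X.f + 1)) * (X.f + 1) + a) := by
    simp only [region, row_div hA0, row_mod hA0]
  -- The three parts add up to a rank, which is at most `p ≤ N ≤ Z`; hence neither they nor their
  -- partial sums overflow.
  have hsplit := rank_split hX t haf p
  have hrank := rankLt_le (X.dig t) a p
  have hN := hX.N_le
  have hA := (ht.mulAdd c7 ((hp.div c3).mulAdd c9 ha (by omega)) (by omega)).cell 10 (by omega)
    hA1 hZ (by omega)
  -- relative counts
  have hE0 : p / X.s * (X.f + 1) + a < X.chunkLen * (X.f + 1) := row_lt hq haf'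
  have hE1 : X.chunkLen * (X.f + 1) < 2 ^ w := by have := hX.cells_le; omega
  have hE := (hp.div c2).mulAdd c9 ha (hE0.trans hE1)
  have hR0 : (p / X.s * (X.f + 1) + a) / X.g < X.relLen :=
    Nat.lt_succ_of_le (Nat.div_le_div_right hE0.le)
  have hR1 := (row_lt htT hR0).trans_le hX.rel_le
  have hRv : X.region 9 (t * X.relLen + (p / X.s * (X.f + 1) + a) / X.g) =
      pack X.V X.g (X.relVal t) ((p / X.s * (X.f + 1) + a) / X.g) := by
    simp only [region, row_div hR0, row_mod hR0]
  have hRb := pack_lt hrel X.g ((p / X.s * (X.f + 1) + a) / X.g)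
  have hpow := hX.pow_le
  have hR := (ht.mulAdd c8 (hE.div c5) (by omega)).cell 9 (by omega) hR1 hZ (by omega)
  have hm : (p / X.s * (X.f + 1) + a) % X.g < X.g := Nat.mod_lt _ hg
  have hVm : X.V ^ ((p / X.s * (X.f + 1) + a) % X.g) ≤ X.V ^ X.g :=
    Nat.pow_le_pow_right (by have := hX.lt_V; omega) hm.le
  have hP := (hE.mod c5).cell 11 (by omega) (hm.trans_le hgZ) hZ
    (lt_of_le_of_lt hVm (by omega))
  -- the table
  have hC1 := (row_lt htT hq).trans_le hX.chunk_le
  have hCv : X.region 8 (t * X.chunkLen + p / X.s) = pack X.f X.s (X.dig t) (p / X.s) := by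
    simp only [region, row_div hq, row_mod hq]
  have hCb := pack_lt (hX.dig_lt t) X.s (p / X.s)
  have hfsZ : X.f ^ X.s ≤ Z := by
    refine le_trans ?_ hX.table_le
    rw [mul_assoc]
    exact Nat.le_mul_of_pos_right _ (by positivity)
  have hC := ((ht.mulAdd c6 (hp.div c2) (by omega)).cell 8 (by omega) hC1 hZ (by omega)).of_eq hCv
  have hT0 := row_lt hCb (Nat.mod_lt p hs)
  have hT1 := (row_lt hT0 haf').trans_le hX.table_le
  have hT2 : (pack X.f X.s (X.dig t) (p / X.s) * X.s + p % X.s) * 1 ≤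
      (pack X.f X.s (X.dig t) (p / X.s) * X.s + p % X.s) * (X.f + 1) :=
    Nat.mul_le_mul_left _ (by omega)
  have hTb : X.tableVal ((pack X.f X.s (X.dig t) (p / X.s) * X.s + p % X.s) * (X.f + 1) + a)
      < 2 ^ w := by omega
  have hT := ((hC.mulAdd c2 (hp.mod c2) (by omega)).mulAdd c9 ha (by omega)).cell 7 (by omega)
    hT1 hZ hTb
  have hRr : pack X.V X.g (X.relVal t) ((p / X.s * (X.f + 1) + a) / X.g) /
      X.V ^ ((p / X.s * (X.f + 1) + a) % X.g) % X.V = X.relVal t (p / X.s * (X.f + 1) + a) := by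
    rw [pack_div_mod hrel _ hm, mul_comm, Nat.div_add_mod]
  have hR' := (((hR.of_eq hRv).div hP).mod c4).of_eq hRr
  exact (((hA.of_eq hAv).add hR' (by omega)).add hT (by
    change _ + X.tableVal _ < _; omega)).of_eq hsplit

end Index

/-! ### Counting by a stable radix sort -/

/-- One step of the radix sort of `Q` by the digit `q / B` in base `f`, keeping only `q % B`. -/
def radixStep (f B : ℕ) (Q : List ℕ) : List ℕ :=
  (List.range f).flatMap fun a => (Q.filter (· / B = a)).map (· % B)

section radixStep

variable {f B : ℕ} {Q : List ℕ}

theorem List.countP_div_lt_succ (B a : ℕ) (Q : List ℕ) :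
    Q.countP (· / B < a + 1) = Q.countP (· / B < a) + Q.countP (· / B = a) := by
  induction Q with
  | nil => simp
  | cons q Q ih =>
    simp only [List.countP_cons, ih, decide_eq_true_eq]
    split_ifs <;> omega

theorem length_flatMap_range (B : ℕ) (Q : List ℕ) (a : ℕ) :
    ((List.range a).flatMap fun a => (Q.filter (· / B = a)).map (· % B)).length =
      Q.countP (· / B < a) := by
  induction a with
  | zero => simp
  | succ a ih =>
    rw [List.range_succ, List.flatMap_append, List.length_append, ih, List.countP_div_lt_succ]
    simp [List.countP_eq_length_filter]

theorem length_radixStep (h : ∀ q ∈ Q, q / B < f) : (radixStep f B Q).length = Q.length := by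
  rw [radixStep, length_flatMap_range, List.countP_eq_length]
  simpa using h

theorem lt_of_mem_radixStep (hB : 0 < B) {q : ℕ} (hq : q ∈ radixStep f B Q) : q < B := by
  simp only [radixStep, List.mem_flatMap, List.mem_map] at hq
  obtain ⟨_, _, r, _, rfl⟩ := hq
  exact Nat.mod_lt _ hB

/-- The bucket of the digit `a` starts after all smaller digits, and by stability its first entries
come from the first `p` entries of `Q`. -/
theorem take_radixStep {a : ℕ} (ha : a < f) (p : ℕ) :
    (radixStep f B Q).take (Q.countP (· / B < a) + (Q.take p).countP (· / B = a)) =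
      ((List.range a).flatMap fun a => (Q.filter (· / B = a)).map (· % B)) ++
        ((Q.take p).filter (· / B = a)).map (· % B) := by
  obtain ⟨k, rfl⟩ := Nat.exists_eq_add_of_lt ha
  have h1 : Q.filter (· / B = a) =
      (Q.take p).filter (· / B = a) ++ (Q.drop p).filter (· / B = a) := by
    rw [← List.filter_append, List.take_append_drop]
  rw [radixStep, show a + k + 1 = (a + 1) + k by omega, List.range_add, List.flatMap_append,
    List.range_succ, List.flatMap_append, List.flatMap_singleton, h1, List.map_append]
  simp only [← List.append_assoc]
  rw [List.append_assoc, List.take_left']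
  rw [List.length_append, length_flatMap_range, List.length_map, List.countP_eq_length_filter,
    List.countP_eq_length_filter]

/-- Numbers are compared lexicographically by quotient and remainder modulo `B`. -/
theorem List.countP_lt_eq (B v : ℕ) (Q : List ℕ) :
    Q.countP (· < v) = Q.countP (· / B < v / B) +
      ((Q.filter (· / B = v / B)).map (· % B)).countP (· < v % B) := by
  induction Q with
  | nil => simp
  | cons q Q ih =>
    have key : q < v ↔ q / B < v / B ∨ q / B = v / B ∧ q % B < v % B := by
      have h1 := Nat.div_add_mod q B
      have h2 := Nat.div_add_mod v B
      constructor
      · intro h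
        rcases (Nat.div_le_div_right (c := B) h.le).lt_or_eq with h3 | h3
        · exact .inl h3
        · rw [h3] at h1; exact .inr ⟨h3, by omega⟩
      · rintro (h | ⟨h, h'⟩)
        · exact lt_of_not_ge fun h3 => absurd (Nat.div_le_div_right (c := B) h3) (by omega)
        · rw [h] at h1; omega
    by_cases h1 : q / B < v / B
    · have h2 : q < v := key.2 (.inl h1)
      have h3 : q / B ≠ v / B := h1.ne
      simp [h1, h2, h3, ih]; omega
    · by_cases h3 : q / B = v / B
      · by_cases h4 : q % B < v % B
        · have h2 : q < v := key.2 (.inr ⟨h3, h4⟩)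
          simp [h2, h3, h4, ih]; omega
        · have h2 : ¬ q < v := fun h => by
            rcases key.1 h with h | h
            · exact h1 h
            · exact h4 h.2
          simp [h2, h3, h4, ih]
      · have h2 : ¬ q < v := fun h => by
          rcases key.1 h with h | h
          · exact h1 h
          · exact h3 h.1
        simp [h1, h2, h3, ih]

/-- The recursion behind the counting of small elements in a prefix by a radix sort. -/
theorem countP_take_add {v : ℕ} (hv : v / B < f) (p : ℕ) :
    (Q.take p).countP (· < v) +
        (((List.range (v / B)).flatMap fun a => (Q.filter (· / B = a)).map (· % B))).countP
          (· < v % B) =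
      (Q.take p).countP (· / B < v / B) +
        ((radixStep f B Q).take (Q.countP (· / B < v / B) +
          (Q.take p).countP (· / B = v / B))).countP (· < v % B) := by
  rw [take_radixStep hv, List.countP_append, List.countP_lt_eq B]
  omega

theorem rankLt_eq_countP {δ : ℕ → ℕ} (h : ∀ i (hi : i < Q.length), δ i = Q[i] / B) (a : ℕ) {p : ℕ}
    (hp : p ≤ Q.length) : rankLt δ a p = (Q.take p).countP (· / B < a) := by
  induction p with
  | zero => simp [rankLt]
  | succ p ih =>
    have := ih (by omega)
    rw [rankLt] at this
    rw [rankLt, Nat.count_succ, this, h p (by omega), List.take_add_one,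
      List.getElem?_eq_getElem (by omega), List.countP_append]
    simp [List.countP_cons]

/-- Counting the elements smaller than `v` at the positions from `l` to `r` by a radix sort. -/
theorem countP_take_sub {v : ℕ} (hv : v / B < f) (hQ : ∀ q ∈ Q, q / B < f)
    {δ : ℕ → ℕ} (h : ∀ i (hi : i < Q.length), δ i = Q[i] / B) {l r : ℕ} (hlr : l ≤ r)
    (hr : r ≤ Q.length) :
    let a := v / B
    let l' := rankLt δ a Q.length + (rankLt δ (a + 1) l - rankLt δ a l)
    let r' := rankLt δ a Q.length + (rankLt δ (a + 1) r - rankLt δ a r)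
    l' ≤ r' ∧ r' ≤ (radixStep f B Q).length ∧
    (Q.take r).countP (· < v) - (Q.take l).countP (· < v) =
      (rankLt δ a r - rankLt δ a l) +
        (((radixStep f B Q).take r').countP (· < v % B) -
          ((radixStep f B Q).take l').countP (· < v % B)) := by
  intro a l' r'
  have e (p : ℕ) (hp : p ≤ Q.length) : rankLt δ (a + 1) p - rankLt δ a p =
      (Q.take p).countP (· / B = a) := by
    rw [rankLt_eq_countP h _ hp, rankLt_eq_countP h _ hp, List.countP_div_lt_succ,
      Nat.add_sub_cancel_left]
  have eN : rankLt δ a Q.length = Q.countP (· / B < a) := by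
    rw [rankLt_eq_countP h _ le_rfl, List.take_length]
  have hl' : l' = Q.countP (· / B < a) + (Q.take l).countP (· / B = a) := by
    simp only [l']; rw [eN, e l (hlr.trans hr)]
  have hr' : r' = Q.countP (· / B < a) + (Q.take r).countP (· / B = a) := by
    simp only [r']; rw [eN, e r hr]
  have hsub (P : ℕ → Bool) : (Q.take l).countP P ≤ (Q.take r).countP P :=
    (List.take_sublist_take_left hlr).countP_le
  have hle : l' ≤ r' := by have := hsub (· / B = a); omega
  refine ⟨hle, ?_, ?_⟩
  · rw [length_radixStep hQ, hr']
    have h1 : (Q.take r).countP (· / B = a) ≤ Q.countP (· / B = a) :=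
      (List.take_sublist r Q).countP_le
    have h2 := List.countP_div_lt_succ B a Q
    have h3 : Q.countP (· / B < a + 1) ≤ Q.length := List.countP_le_length
    omega
  -- The contribution of the buckets before `a` is the same for `l` and `r` and cancels.
  · have h1 := countP_take_add (Q := Q) hv l
    have h2 := countP_take_add (Q := Q) hv r
    change (Q.take l).countP (· < v) + _ = (Q.take l).countP (· / B < a) + _ at h1
    change (Q.take r).countP (· < v) + _ = (Q.take r).countP (· / B < a) + _ at h2
    rw [← hl'] at h1
    rw [← hr'] at h2
    rw [rankLt_eq_countP h _ hr, rankLt_eq_countP h _ (hlr.trans hr)]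
    have h3 := hsub (· / B < a)
    have h4 : ((radixStep f B Q).take l').countP (· < v % B) ≤
        ((radixStep f B Q).take r').countP (· < v % B) :=
      (List.take_sublist_take_left hle).countP_le
    change _ = (Q.take r).countP (· / B < a) - (Q.take l).countP (· / B < a) + _
    omega

end radixStep

/-! ### The descent through the digits of the bound -/

namespace Index

open WordRAM

variable {X : Index} {w Z T : ℕ}

/-- The digit sequences `t, t + 2, …` hold the digits of the `m`-digit numbers `Q` and of the lists
obtained from it by radix sort. -/
def Codes (X : Index) (T : ℕ) : ℕ → ℕ → List ℕ → Prop
  | 0, _, _ => True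
  | m + 1, t, Q => t < T ∧ (∀ i (hi : i < Q.length), X.dig t i = Q[i] / X.f ^ m) ∧
      Codes X T m (t + 2) (radixStep X.f (X.f ^ m) Q)

/-- One step of the descent. The registers `4, …, 10` hold the remaining bound `v`, the number `t`
of the digit sequence, the number of remaining digits, the weight of the next digit, the current
interval of positions, and the count. -/
def bodyProg : Prog :=
  .seq (.assign 11 (.bin .div (.reg 4) (.reg 7))) <|
  .seq (.assign 12 (rankExpr (.reg 5) (.reg 11) (.reg 8))) <|
  .seq (.assign 13 (rankExpr (.reg 5) (.reg 11) (.reg 9))) <|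
  .seq (.assign 14 (rankExpr (.reg 5) (.reg 11) (cell 0 (.lit 0)))) <|
  .seq (.assign 10 (.bin .add (.reg 10) (.bin .sub (.reg 13) (.reg 12)))) <|
  .seq (.assign 11 (.bin .add (.reg 11) (.lit 1))) <|
  .seq (.assign 8 (.bin .add (.reg 14) (.bin .sub
    (rankExpr (.reg 5) (.reg 11) (.reg 8)) (.reg 12)))) <|
  .seq (.assign 9 (.bin .add (.reg 14) (.bin .sub
    (rankExpr (.reg 5) (.reg 11) (.reg 9)) (.reg 13)))) <|
  .seq (.assign 4 (.bin .mod (.reg 4) (.reg 7))) <|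
  .seq (.assign 7 (.bin .div (.reg 7) (cell 0 (.lit 1)))) <|
  .seq (.assign 5 (.bin .add (.reg 5) (.lit 2))) <|
  .assign 6 (.bin .sub (.reg 6) (.lit 1))

/-- The time of a program without branches. -/
def _root_.WordRAM.Prog.straightCost : Prog → ℕ
  | .assign _ e => e.cost + 1
  | .seq p q => p.straightCost + q.straightCost
  | _ => 0

theorem Fits.T_le (hX : X.Fits w Z T) : T ≤ Z :=
  (Nat.le_mul_of_pos_right T (Nat.succ_pos _)).trans hX.chunk_le

theorem Fits.f_lt (hX : X.Fits w Z T) : X.f < Z := by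
  refine lt_of_lt_of_le (Nat.lt_succ_self _) (le_trans ?_ hX.table_le)
  exact Nat.le_mul_of_pos_left _ (Nat.mul_pos (pow_pos hX.f_pos _) hX.s_pos)

theorem Fits.ev_const (hX : X.Fits w Z T) {ρ : ℕ → ℕ} {i v : ℕ} (hi : i < 10)
    (hv : X.region 0 i = v) (hb : v ≤ Z) : Ev (interleave w Z X.region) ρ (cell 0 (.lit i)) v := by
  have h1 := hX.addr
  have h2 := hX.ten_le
  exact ((Ev.lit i (by omega)).cell 0 (by omega) (by omega) h1 (by omega)).of_eq hv

/-- Ranks are available only for "digit smaller than"; the number of digits equal to `v / P` is the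
difference of the ranks for `v / P + 1` and `v / P`. Added to the start of the bucket, it gives the
new ends of the interval. -/
theorem Fits.runs_body (hX : X.Fits w Z T) {ρ : ℕ → ℕ} {v t m l r acc P : ℕ}
    (h4 : ρ 4 = v) (h5 : ρ 5 = t) (h6 : ρ 6 = m + 1) (h7 : ρ 7 = P) (h8 : ρ 8 = l) (h9 : ρ 9 = r)
    (h10 : ρ 10 = acc) (ht : t < T) (hv : v / P < X.f) (hl : l ≤ r) (hr : r ≤ X.N)
    (hacc : acc + (rankLt (X.dig t) (v / P) r - rankLt (X.dig t) (v / P) l) ≤ X.N) :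
    let l' := rankLt (X.dig t) (v / P) X.N +
      (rankLt (X.dig t) (v / P + 1) l - rankLt (X.dig t) (v / P) l)
    let r' := rankLt (X.dig t) (v / P) X.N +
      (rankLt (X.dig t) (v / P + 1) r - rankLt (X.dig t) (v / P) r)
    ∃ ρ', Runs (interleave w Z X.region) bodyProg ρ bodyProg.straightCost ρ' ∧
      ρ' 4 = v % P ∧ ρ' 5 = t + 2 ∧ ρ' 6 = m ∧ ρ' 7 = P / X.f ∧ ρ' 8 = l' ∧ ρ' 9 = r' ∧
      ρ' 10 = acc + (rankLt (X.dig t) (v / P) r - rankLt (X.dig t) (v / P) l) ∧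
      ρ' 0 = ρ 0 ∧ ρ' 1 = ρ 1 := by
  intro l' r'
  have hZ := hX.addr
  have hten := hX.ten_le
  have hN := hX.N_le
  have hT := hX.T_le
  have hf := hX.f_lt
  have b1 := rankLt_le (X.dig t) (v / P) X.N
  have b2 := rankLt_le (X.dig t) (v / P + 1) l
  have b3 := rankLt_le (X.dig t) (v / P + 1) r
  have m1 := rankLt_mono_right (X.dig t) (v / P) hl
  have m2 := rankLt_mono_left (X.dig t) l (Nat.le_succ (v / P))
  have m3 := rankLt_mono_left (X.dig t) r (Nat.le_succ (v / P))
  have hrun : Runs (interleave w Z X.region) bodyProg ρ _ _ :=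
    Runs.seq (Runs.assign 11 ((Ev.reg_of_eq h4).div (Ev.reg_of_eq h7))) <|
      Runs.seq (Runs.assign 12 (hX.ev_rank (Ev.reg_of_eq (v := t) (by simp [h5]))
        (Ev.reg_of_eq (v := v / P) (by simp)) (Ev.reg_of_eq (v := l) (by simp [h8])) ht hv.le
        (by omega))) <|
      Runs.seq (Runs.assign 13 (hX.ev_rank (Ev.reg_of_eq (v := t) (by simp [h5]))
        (Ev.reg_of_eq (v := v / P) (by simp)) (Ev.reg_of_eq (v := r) (by simp [h9])) ht hv.le
        (by omega))) <|
      Runs.seq (Runs.assign 14 (hX.ev_rank (Ev.reg_of_eq (v := t) (by simp [h5]))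
        (Ev.reg_of_eq (v := v / P) (by simp))
        (hX.ev_const (v := X.N) (by omega) rfl (by omega)) ht hv.le le_rfl)) <|
      Runs.seq (Runs.assign 10 ((Ev.reg_of_eq (v := acc) (by simp [h10])).add
        ((Ev.reg_of_eq (v := rankLt (X.dig t) (v / P) r) (by simp)).sub
          (Ev.reg_of_eq (v := rankLt (X.dig t) (v / P) l) (by simp)) (by omega)) (by omega))) <|
      Runs.seq (Runs.assign 11 ((Ev.reg_of_eq (v := v / P) (by simp)).add (Ev.lit 1 (by omega))
        (by omega))) <|
      Runs.seq (Runs.assign 8 ((Ev.reg_of_eq (v := rankLt (X.dig t) (v / P) X.N) (by simp)).add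
        ((hX.ev_rank (Ev.reg_of_eq (v := t) (by simp [h5]))
          (Ev.reg_of_eq (v := v / P + 1) (by simp))
          (Ev.reg_of_eq (v := l) (by simp [h8])) ht (by omega) (by omega)).sub
          (Ev.reg_of_eq (v := rankLt (X.dig t) (v / P) l) (by simp)) (by omega)) (by omega))) <|
      Runs.seq (Runs.assign 9 ((Ev.reg_of_eq (v := rankLt (X.dig t) (v / P) X.N) (by simp)).add
        ((hX.ev_rank (Ev.reg_of_eq (v := t) (by simp [h5]))
          (Ev.reg_of_eq (v := v / P + 1) (by simp))
          (Ev.reg_of_eq (v := r) (by simp [h9])) ht (by omega) (by omega)).sub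
          (Ev.reg_of_eq (v := rankLt (X.dig t) (v / P) r) (by simp)) (by omega)) (by omega))) <|
      Runs.seq (Runs.assign 4 ((Ev.reg_of_eq (v := v) (by simp [h4])).mod
        (Ev.reg_of_eq (v := P) (by simp [h7])))) <|
      Runs.seq (Runs.assign 7 ((Ev.reg_of_eq (v := P) (by simp [h7])).div
        (hX.ev_const (v := X.f) (by omega) rfl (by omega)))) <|
      Runs.seq (Runs.assign 5 ((Ev.reg_of_eq (v := t) (by simp [h5])).add (Ev.lit 2 (by omega))
        (by omega))) <|
      Runs.assign 6 ((Ev.reg_of_eq (v := m + 1) (by simp [h6])).sub (Ev.lit 1 (by omega))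
        (by omega))
  simp only [l', r']
  exact ⟨_, hrun.mono le_rfl, by simp⟩

/-- The descent. -/
def loopProg : Prog := .loop (.reg 6) bodyProg

/-- The accumulator plus the number of entries still to be counted is invariant. It stays at most
`N`, which excludes overflow. -/
theorem Fits.runs_loop (hX : X.Fits w Z T) (m : ℕ) : ∀ {ρ : ℕ → ℕ} {v t l r acc : ℕ} {Q : List ℕ},
    ρ 4 = v → ρ 5 = t → ρ 6 = m → ρ 7 = X.f ^ m / X.f → ρ 8 = l → ρ 9 = r → ρ 10 = acc →
    X.Codes T m t Q → Q.length = X.N → (∀ q ∈ Q, q < X.f ^ m) → v < X.f ^ m → l ≤ r → r ≤ X.N →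
    acc + ((Q.take r).countP (· < v) - (Q.take l).countP (· < v)) ≤ X.N →
    ∃ ρ', Runs (interleave w Z X.region) loopProg ρ (2 + m * (2 + bodyProg.straightCost)) ρ' ∧
      ρ' 10 = acc + ((Q.take r).countP (· < v) - (Q.take l).countP (· < v)) ∧
      ρ' 0 = ρ 0 ∧ ρ' 1 = ρ 1 := by
  induction m with
  | zero =>
    intro ρ v t l r acc Q h4 h5 h6 h7 h8 h9 h10 _ _ _ hv _ _ _
    -- Without digits left, `v < 1`, and no entry is smaller than `v`.
    have hv0 : v = 0 := by simpa using hv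
    exact ⟨ρ, (Runs.loop_done (Ev.reg_of_eq h6) rfl).mono (by simp [Expr.cost]), by simp [h10, hv0],
      rfl, rfl⟩
  | succ m ih =>
    intro ρ v t l r acc Q h4 h5 h6 h7 h8 h9 h10 hC hlen hQ hv hl hr hacc
    obtain ⟨htT, hdig, hC'⟩ := hC
    have hf := hX.f_pos
    have hP : 0 < X.f ^ m := pow_pos hf m
    have hdf {q : ℕ} (hq : q < X.f ^ (m + 1)) : q / X.f ^ m < X.f :=
      (Nat.div_lt_iff_lt_mul hP).2 (by rwa [pow_succ, mul_comm] at hq)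
    have hQf : ∀ q ∈ Q, q / X.f ^ m < X.f := fun q hq => hdf (hQ q hq)
    rw [pow_succ, Nat.mul_div_cancel _ hf] at h7
    obtain ⟨hlr', hr', hstep⟩ := countP_take_sub (hdf hv) hQf hdig hl (by omega)
    rw [length_radixStep hQf, hlen] at hr'
    rw [hlen] at hlr' hstep
    rw [hstep] at hacc ⊢
    obtain ⟨ρ', hrun, g4, g5, g6, g7, g8, g9, g10, g0, g1⟩ :=
      hX.runs_body h4 h5 h6 h7 h8 h9 h10 htT (hdf hv) hl hr (by omega)
    obtain ⟨ρ'', hrun', k10, k0, k1⟩ := ih g4 g5 g6 g7 g8 g9 g10 hC'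
      ((length_radixStep hQf).trans hlen) (fun q hq => lt_of_mem_radixStep hP hq)
      (Nat.mod_lt _ hP) hlr' hr' (by omega)
    refine ⟨ρ'', (Runs.loop_step (Ev.reg_of_eq h6) (by omega) hrun hrun').mono ?_, ?_,
      k0.trans g0, k1.trans g1⟩
    · simp only [Expr.cost, add_mul]
      omega
    · rw [k10]; omega

end Index

/-! ### Blocks of rows along the diagonal -/

/-- The offset of the point `p` in its block, cut off at `M - 1`. The blocks have `2 * K` rows and
start at the even (`π = 0`) or the odd (`π = 1`) multiples of `K`. -/
def blockKey (K π M : ℕ) (p : ℕ × ℕ) : ℕ :=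
  min (p.1 - (p.2 / K - (p.2 / K + π) % 2) * K) (M - 1)

/-- The row `y` lies in the lower half of the block starting at `y / K * K`, and `x` is less than
`K` rows higher, so the row of `p` is in the same block. The bound `x + 1 - y / K * K` is below `2 *
K ≤ M`, so the cut-off does not affect the comparison. -/
theorem blockKey_lt_iff {K M x y : ℕ} {p : ℕ × ℕ} (hd : x - y + 1 < K) (hM : 2 * K ≤ M)
    (hy : y ≤ p.2) (hx : p.2 ≤ x) (hp : p.2 ≤ p.1) :
    blockKey K (y / K % 2) M p < x + 1 - y / K * K ↔ p.1 ≤ x := by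
  have hK : 0 < K := by omega
  have h1 : y / K * K ≤ y := Nat.div_mul_le_self y K
  have h2 : y < y / K * K + K := by
    have := Nat.lt_div_mul_add (a := y) hK; omega
  have h3 : p.2 / K - (p.2 / K + y / K % 2) % 2 = y / K := by
    have h4 : y / K ≤ p.2 / K := Nat.div_le_div_right hy
    have h5 : p.2 / K < y / K + 2 := by
      rw [Nat.div_lt_iff_lt_mul hK, add_mul]; omega
    generalize y / K = q at h4 h5 ⊢
    generalize p.2 / K = q' at h4 h5 ⊢
    omega
  rw [blockKey, h3]
  omega

theorem List.take_countP_eq_filter {α : Type*} (key : α → ℕ) (b : ℕ) :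
    ∀ {L : List α}, L.Pairwise (fun p q => key p ≤ key q) →
      L.take (L.countP (key · < b)) = L.filter (key · < b)
  | [], _ => by simp
  | p :: L, h => by
    rw [List.pairwise_cons] at h
    by_cases hp : key p < b
    · simp [hp, List.take_countP_eq_filter key b h.2]
    · have h0 : L.countP (key · < b) = 0 := by
        rw [List.countP_eq_zero]
        intro q hq
        have := h.1 q hq
        simp; omega
      have h1 : (p :: L).countP (key · < b) = 0 := by simp [hp, h0]
      rw [h1, List.take_zero, eq_comm, List.filter_eq_nil_iff]
      rw [List.countP_eq_zero] at h1
      exact h1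

/-! ### The query programs -/

namespace Index

open WordRAM

/-- The structure `X` represents the set `S`, given by the list `L` of its points in the order of
their rows, and its arrays of distances have the right contents. -/
structure Represents (X : Index) (S : Finset (ℕ × ℕ)) (L : List (ℕ × ℕ)) (n Z T : ℕ) : Prop where
  perm : L.Perm S.toList
  sorted : L.Pairwise fun p q => p.2 ≤ q.2
  N_eq : X.N = L.length
  pos_eq : ∀ i, X.pos i = L.countP (·.2 < i)
  cx_eq : ∀ i, X.cx i = L.countP (·.1 ≤ i)
  n_lt : n + 1 < Z
  lt_bk : ∀ d ≤ n, d + 1 < X.bk d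
  bk_le : ∀ d ≤ n, X.bk d ≤ Z
  two_bk_le : ∀ d ≤ n, 2 * X.bk d ≤ X.f ^ X.depth d
  start_le : ∀ d ≤ n, X.start d ≤ Z
  depth_le : ∀ d ≤ n, X.depth d ≤ Z
  pw_eq : ∀ d ≤ n, X.pw d = X.f ^ X.depth d / X.f
  pw_le : ∀ d ≤ n, X.pw d ≤ Z
  codes : ∀ d ≤ n, ∀ π < 2, X.Codes T (X.depth d) (X.start d + π)
    (L.map (blockKey (X.bk d) π (X.f ^ X.depth d)))

/-- The parameters of the query `(x, y)` with `y ≤ x`. -/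
def setupProg : Prog :=
  .seq (.assign 2 (.bin .sub (.reg 0) (.reg 1))) <|
  .seq (.assign 3 (cell 3 (.reg 2))) <|
  .seq (.assign 4 (.bin .sub (.bin .add (.reg 0) (.lit 1))
    (.bin .mul (.bin .div (.reg 1) (.reg 3)) (.reg 3)))) <|
  .seq (.assign 5 (.bin .add (cell 4 (.reg 2))
    (.bin .mod (.bin .div (.reg 1) (.reg 3)) (.lit 2)))) <|
  .seq (.assign 6 (cell 5 (.reg 2))) <|
  .seq (.assign 7 (cell 6 (.reg 2))) <|
  .seq (.assign 8 (cell 1 (.reg 1))) <|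
  .assign 9 (cell 1 (.bin .add (.reg 0) (.lit 1)))

/-- Counts the points with first coordinate at most `x` and second coordinate at least `y`. -/
def countProg : Prog :=
  .ite (.bin .lt (.reg 0) (.reg 1)) (.assign 10 (.lit 0)) (.seq setupProg loopProg)

variable {X : Index} {S : Finset (ℕ × ℕ)} {L : List (ℕ × ℕ)} {n w Z T : ℕ}

theorem Represents.countP_eq_card (h : X.Represents S L n Z T) (P : ℕ × ℕ → Prop)
    [DecidablePred P] : L.countP (fun p => decide (P p)) = (S.filter P).card := by
  rw [h.perm.countP_eq, ← Multiset.coe_countP, Finset.coe_toList, Multiset.countP_eq_card_filter]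
  rfl

theorem Represents.interval_count (h : X.Represents S L n Z T) {x y d : ℕ} (hS : BelowDiagonal n S)
    (hd : d = x - y) (hdn : d ≤ n) (hyx : y ≤ x) :
    ((L.map (blockKey (X.bk d) (y / X.bk d % 2) (X.f ^ X.depth d))).take (X.pos (x + 1))).countP
        (· < x + 1 - y / X.bk d * X.bk d) -
      ((L.map (blockKey (X.bk d) (y / X.bk d % 2) (X.f ^ X.depth d))).take (X.pos y)).countP
        (· < x + 1 - y / X.bk d * X.bk d) =
    (S.filter fun p => p.1 ≤ x ∧ y ≤ p.2).card := by
  have h1 := h.lt_bk d hdn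
  have h2 := h.two_bk_le d hdn
  rw [← h.countP_eq_card, ← List.map_take, ← List.map_take, List.countP_map, List.countP_map,
    h.pos_eq, h.pos_eq, List.take_countP_eq_filter _ _ h.sorted,
    List.take_countP_eq_filter _ _ h.sorted, List.countP_filter, List.countP_filter]
  have hL : ∀ p ∈ L, p.2 ≤ p.1 := fun p hp =>
    (hS p (by rw [← Finset.mem_toList]; exact h.perm.mem_iff.1 hp)).2.1
  clear h
  -- As a sum, the identity can be checked one point at a time.
  rw [Nat.sub_eq_iff_eq_add']
  · induction L with
    | nil => simp
    | cons p L ih =>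
      have hp : p.2 ≤ p.1 := hL p (by simp)
      have key := fun a b => blockKey_lt_iff (x := x) (y := y) (p := p) (hd ▸ h1) h2 a b hp
      rw [List.countP_cons, List.countP_cons, List.countP_cons,
        ih fun q hq => hL q (by simp [hq])]
      simp only [Function.comp, Bool.and_eq_true, decide_eq_true_eq]
      by_cases a : y ≤ p.2
      · by_cases b : p.2 ≤ x
        · simp only [key a b]
          have c : ¬ p.2 < y := by omega
          have c' : p.2 < x + 1 := by omega
          simp only [a, c, c', and_true, and_false, if_false]
          omega
        -- A row above `x`: since `p.2 ≤ p.1`, the point is not in the quadrant either.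
        · have c : ¬ p.2 < y := by omega
          have c' : ¬ p.2 < x + 1 := by omega
          have c'' : ¬ p.1 ≤ x := by omega
          simp [c, c', c'']
      -- A row below `y`: the point is in both prefixes and cancels.
      · have c : p.2 < y := by omega
        have c' : p.2 < x + 1 := by omega
        simp only [a, c, c', and_true, and_false, if_false]
        omega
  · refine List.countP_mono_left fun p _ => ?_
    simp only [Bool.and_eq_true, decide_eq_true_eq]
    exact fun ⟨a, b⟩ => ⟨a, by omega⟩

theorem Represents.runs_count (h : X.Represents S L n Z T) (hX : X.Fits w Z T)
    (hS : BelowDiagonal n S) {ρ : ℕ → ℕ} {x y : ℕ} (h0 : ρ 0 = x) (h1 : ρ 1 = y) (h10 : ρ 10 = 0)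
    (hx : x ≤ n) :
    ∃ ρ', Runs (interleave w Z X.region) countProg ρ
        (20 + setupProg.straightCost + X.depth (x - y) * (2 + bodyProg.straightCost)) ρ' ∧
      ρ' 10 = (S.filter fun p => p.1 ≤ x ∧ y ≤ p.2).card ∧ ρ' 0 = x ∧ ρ' 1 = y := by
  have hZ := hX.addr
  have hten := hX.ten_le
  have hn := h.n_lt
  have hlt := (Ev.reg_of_eq h0 (μ := interleave w Z X.region)).lt (Ev.reg_of_eq h1) (by omega)
  by_cases hxy : x < y
  · refine ⟨_, (Runs.ite_true hlt (by simp [hxy])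
      (Runs.assign 10 (Ev.lit 0 (by omega)))).mono (by simp only [Expr.cost]; omega), ?_, by simp [h0],
        by simp [h1]⟩
    rw [Function.update_self, eq_comm, Finset.card_eq_zero, Finset.filter_eq_empty_iff]
    intro p hp
    have := (hS p hp).2.1
    omega
  · obtain ⟨d, hd⟩ : ∃ d, d = x - y := ⟨_, rfl⟩
    have hdn : d ≤ n := by omega
    have a1 := h.lt_bk d hdn
    have a2 := h.bk_le d hdn
    have a3 := h.start_le d hdn
    have a4 := h.depth_le d hdn
    have a5 := h.pw_le d hdn
    have hN := hX.N_le
    have hpos (i : ℕ) : X.pos i ≤ X.N := by rw [h.pos_eq, h.N_eq]; exact List.countP_le_length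
    have p1 := hpos y
    have p2 := hpos (x + 1)
    have p3 : X.pos y ≤ X.pos (x + 1) := by
      rw [h.pos_eq, h.pos_eq]
      refine List.countP_mono_left fun p _ => ?_
      simp only [decide_eq_true_eq]
      omega
    have b1 := Nat.div_mul_le_self y (X.bk d)
    have b2 := Nat.mod_lt (y / X.bk d) (show 2 > 0 by omega)
    have e2 : d < Z := by omega
    have hset : Runs (interleave w Z X.region) setupProg ρ _ _ :=
      Runs.seq (Runs.assign 2 (((Ev.reg_of_eq h0).sub (Ev.reg_of_eq h1) (by omega)).of_eq
        hd.symm)) <|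
      Runs.seq (Runs.assign 3 ((Ev.reg_of_eq (v := d) (by simp)).cell 3 (by omega) e2 hZ
        (by change X.bk d < _; omega))) <|
      Runs.seq (Runs.assign 4 (((Ev.reg_of_eq (v := x) (by simp [h0])).add (Ev.lit 1 (by omega))
        (by omega)).sub (((Ev.reg_of_eq (v := y) (by simp [h1])).div
          (Ev.reg_of_eq (v := X.bk d) (by simp [region]))).mul
          (Ev.reg_of_eq (v := X.bk d) (by simp [region])) (by omega)) (by omega))) <|
      Runs.seq (Runs.assign 5 (((Ev.reg_of_eq (v := d) (by simp)).cell 4 (by omega) e2 hZ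
        (by change X.start d < _; omega)).add (((Ev.reg_of_eq (v := y) (by simp [h1])).div
          (Ev.reg_of_eq (v := X.bk d) (by simp [region]))).mod (Ev.lit 2 (by omega)))
          (by change X.start d + _ < _; omega))) <|
      Runs.seq (Runs.assign 6 ((Ev.reg_of_eq (v := d) (by simp)).cell 5 (by omega) e2 hZ
        (by change X.depth d < _; omega))) <|
      Runs.seq (Runs.assign 7 ((Ev.reg_of_eq (v := d) (by simp)).cell 6 (by omega) e2 hZ
        (by change X.pw d < _; omega))) <|
      Runs.seq (Runs.assign 8 ((Ev.reg_of_eq (v := y) (by simp [h1])).cell 1 (by omega) (by omega)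
        hZ (by change X.pos y < _; omega))) <|
      Runs.assign 9 (((Ev.reg_of_eq (v := x) (by simp [h0])).add (Ev.lit 1 (by omega))
        (by omega)).cell 1 (by omega) (by omega) hZ (by change X.pos (x + 1) < _; omega))
    obtain ⟨ρ₁, hset', f4, f5, f6, f7, f8, f9, f10, f0, f1⟩ : ∃ ρ₁,
        Runs (interleave w Z X.region) setupProg ρ setupProg.straightCost ρ₁ ∧
        ρ₁ 4 = x + 1 - y / X.bk d * X.bk d ∧ ρ₁ 5 = X.start d + y / X.bk d % 2 ∧
        ρ₁ 6 = X.depth d ∧ ρ₁ 7 = X.f ^ X.depth d / X.f ∧ ρ₁ 8 = X.pos y ∧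
        ρ₁ 9 = X.pos (x + 1) ∧ ρ₁ 10 = 0 ∧ ρ₁ 0 = x ∧ ρ₁ 1 = y :=
      ⟨_, hset.mono le_rfl, by simp [region, h.pw_eq d hdn, h0, h1, h10]⟩
    have hcount := h.interval_count hS hd hdn (by omega)
    have b3 := h.two_bk_le d hdn
    have b4 : y < y / X.bk d * X.bk d + X.bk d := by
      have := Nat.lt_div_mul_add (a := y) (show 0 < X.bk d by omega); omega
    obtain ⟨ρ', hloop, g10, g0, g1⟩ := hX.runs_loop (X.depth d)
      (Q := L.map (blockKey (X.bk d) (y / X.bk d % 2) (X.f ^ X.depth d)))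
      f4 f5 f6 f7 f8 f9 f10 (h.codes d hdn _ b2)
      (by simp [h.N_eq]) (by
        simp only [List.mem_map, forall_exists_index, and_imp, forall_apply_eq_imp_iff₂]
        intro p _
        simp only [blockKey]; omega) (by omega) p3 p2 (by
        rw [hcount, zero_add, ← h.countP_eq_card, h.N_eq]; exact List.countP_le_length)
    refine ⟨ρ', (Runs.ite_false hlt (by simp [hxy]) (hset'.seq hloop)).mono ?_, ?_, ?_, ?_⟩
    · rw [← hd]
      simp only [Expr.cost]
      omega
    · rw [g10, zero_add, hcount]
    · rw [g0, f0]
    · rw [g1, f1]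

/-- The register `0` of the call of `countProg` for each kind of quadrant. -/
def argX : Quadrant → Expr
  | .leLe => .reg 0
  | .leGe => .reg 0
  | .geLe => .bin .sub (.reg 0) (.lit 1)
  | .geGe => .bin .sub (.reg 0) (.lit 1)

/-- The register `1` of the call of `countProg` for each kind of quadrant. -/
def argY : Quadrant → Expr
  | .leLe => .bin .add (.reg 1) (.lit 1)
  | .leGe => .reg 1
  | .geLe => .bin .add (.reg 1) (.lit 1)
  | .geGe => .reg 1

/-- The answer for each kind of quadrant from the count in register `10`. -/
def answer : Quadrant → Expr
  | .leLe => .bin .sub (cell 2 (.reg 0)) (.reg 10)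
  | .leGe => .reg 10
  | .geLe => .bin .sub (.bin .add (cell 1 (.reg 1)) (.reg 10)) (cell 2 (.reg 0))
  | .geGe => .bin .sub (.bin .sub (cell 0 (.lit 0)) (cell 1 (.reg 1))) (.reg 10)

/-- The query program. -/
def queryProg (Q : Quadrant) : Prog :=
  .seq (.assign 0 (argX Q)) <| .seq (.assign 1 (argY Q)) <| .seq countProg (.assign 0 (answer Q))

theorem Represents.runs_query (h : X.Represents S L n Z T) (hX : X.Fits w Z T)
    (hS : BelowDiagonal n S) (Q : Quadrant) {ρ : ℕ → ℕ} {x y : ℕ} (h0 : ρ 0 = x) (h1 : ρ 1 = y)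
    (h10 : ρ 10 = 0) (hx1 : 1 ≤ x) (hx : x ≤ n) (hy : y ≤ n) :
    ∃ d ≤ x - y, ∃ ρ', Runs (interleave w Z X.region) (queryProg Q) ρ
        (60 + setupProg.straightCost + X.depth d * (2 + bodyProg.straightCost)) ρ' ∧
      ρ' 0 = dominanceCount S x y Q := by
  have hZ := hX.addr
  have hten := hX.ten_le
  have hn := h.n_lt
  have hN := hX.N_le
  obtain ⟨x', y', hx', hy', hxx, hyy⟩ : ∃ x' y', (x' = x ∧ (Q = .leLe ∨ Q = .leGe) ∨
      x' = x - 1 ∧ (Q = .geLe ∨ Q = .geGe)) ∧ (y' = y ∧ (Q = .leGe ∨ Q = .geGe) ∨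
      y' = y + 1 ∧ (Q = .leLe ∨ Q = .geLe)) ∧ Ev (interleave w Z X.region) ρ (argX Q) x' ∧
      ∀ x', Ev (interleave w Z X.region) (Function.update ρ 0 x') (argY Q) y' := by
    have ex := Ev.reg_of_eq (μ := interleave w Z X.region) h0
    have ey := fun x' => Ev.reg_of_eq (μ := interleave w Z X.region)
      (ρ := Function.update ρ 0 x') (r := 1) (v := y) (by simp [h1])
    have ex' := ex.sub (Ev.lit 1 (by omega)) hx1
    have ey' := fun x' => (ey x').add (Ev.lit 1 (by omega)) (by omega)
    cases Q
    · exact ⟨x, y + 1, by simp, by simp, ex, ey'⟩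
    · exact ⟨x, y, by simp, by simp, ex, ey⟩
    · exact ⟨x - 1, y + 1, by simp, by simp, ex', ey'⟩
    · exact ⟨x - 1, y, by simp, by simp, ex', ey⟩
  obtain ⟨ρ', hrun, g10, g0, g1⟩ := h.runs_count hX hS
    (ρ := Function.update (Function.update ρ 0 x') 1 y') (x := x') (y := y')
    (by simp) (by simp) (by simp [h10]) (by omega)
  -- Shifting the apex to pass to complements never increases the truncated difference `x - y`.
  refine ⟨x' - y', by omega, Function.update ρ' 0 (dominanceCount S x y Q), ?_, by simp⟩
  have hcard (P : ℕ × ℕ → Prop) [DecidablePred P] : (S.filter P).card ≤ X.N := by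
    rw [← h.countP_eq_card, h.N_eq]; exact List.countP_le_length
  have hcx : X.cx x' = (S.filter fun p => p.1 ≤ x').card := by rw [h.cx_eq, h.countP_eq_card]
  have hpos : X.pos y' = (S.filter fun p => p.2 < y').card := by rw [h.pos_eq, h.countP_eq_card]
  have hNc : X.N = S.card := by
    have := h.countP_eq_card fun _ => True
    simpa [h.N_eq] using this
  have ecx : Ev (interleave w Z X.region) ρ' (cell 2 (.reg 0)) (X.cx x') :=
    (Ev.reg_of_eq g0).cell 2 (by omega) (by omega) hZ (by
      change X.cx x' < _; have := hcard fun p => p.1 ≤ x'; omega)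
  have epos : Ev (interleave w Z X.region) ρ' (cell 1 (.reg 1)) (X.pos y') :=
    (Ev.reg_of_eq g1).cell 1 (by omega) (by omega) hZ (by
      change X.pos y' < _; have := hcard fun p => p.2 < y'; omega)
  have eacc := Ev.reg_of_eq (μ := interleave w Z X.region) g10
  have eN : Ev (interleave w Z X.region) ρ' (cell 0 (.lit 0)) X.N :=
    hX.ev_const (by omega) rfl hN
  have hans : Ev (interleave w Z X.region) ρ' (answer Q) (dominanceCount S x y Q) := by
    have c1 := hcard fun p => p.1 ≤ x' ∧ y' ≤ p.2
    have c2 := hcard fun p => p.2 < y'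
    -- The apex cuts `S` into four cells; each quadrant is one of them, obtained from row and column
    -- counts and the one cell that was computed.
    have s1 : (S.filter fun p => p.1 ≤ x').card = (S.filter fun p => p.1 ≤ x' ∧ y' ≤ p.2).card +
        (S.filter fun p => p.1 ≤ x' ∧ p.2 < y').card := by
      rw [← Finset.card_filter_add_card_filter_not (s := S.filter fun p => p.1 ≤ x')
        (fun p => y' ≤ p.2), Finset.filter_filter, Finset.filter_filter]
      simp only [not_le]
    have s2 : (S.filter fun p => p.2 < y').card = (S.filter fun p => p.1 ≤ x' ∧ p.2 < y').card +
        (S.filter fun p => x' < p.1 ∧ p.2 < y').card := by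
      rw [← Finset.card_filter_add_card_filter_not (s := S.filter fun p => p.2 < y')
        (fun p => p.1 ≤ x'), Finset.filter_filter, Finset.filter_filter]
      simp only [not_le, and_comm]
    have s3 : S.card = (S.filter fun p => p.2 < y').card + (S.filter fun p => y' ≤ p.2).card := by
      rw [← Finset.card_filter_add_card_filter_not (s := S) (fun p => p.2 < y')]
      simp only [not_lt]
    have s4 : (S.filter fun p => y' ≤ p.2).card = (S.filter fun p => p.1 ≤ x' ∧ y' ≤ p.2).card +
        (S.filter fun p => x' < p.1 ∧ y' ≤ p.2).card := by
      rw [← Finset.card_filter_add_card_filter_not (s := S.filter fun p => y' ≤ p.2)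
        (fun p => p.1 ≤ x'), Finset.filter_filter, Finset.filter_filter]
      simp only [not_le, and_comm]
    cases Q
    · obtain ⟨rfl, rfl⟩ : x' = x ∧ y' = y + 1 := by simp at hx' hy'; omega
      refine (ecx.sub eacc (by omega)).of_eq ?_
      simp only [dominanceCount]
      simp only [Nat.lt_succ_iff] at s1
      omega
    · obtain ⟨rfl, rfl⟩ : x' = x ∧ y' = y := by simp at hx' hy'; omega
      exact eacc
    · obtain ⟨rfl, rfl⟩ : x' = x - 1 ∧ y' = y + 1 := by simp at hx' hy'; omega
      refine ((epos.add eacc (by omega)).sub ecx (by omega)).of_eq ?_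
      simp only [dominanceCount]
      have : ∀ z, x - 1 < z ↔ x ≤ z := fun z => by omega
      simp only [Nat.lt_succ_iff, this] at s1 s2 hpos
      omega
    · obtain ⟨rfl, rfl⟩ : x' = x - 1 ∧ y' = y := by simp at hx' hy'; omega
      refine ((eN.sub epos (by omega)).sub eacc (by omega)).of_eq ?_
      simp only [dominanceCount]
      have : ∀ z, x - 1 < z ↔ x ≤ z := fun z => by omega
      simp only [this] at s4
      omega
  refine ((Runs.assign 0 hxx).seq ((Runs.assign 1 (hyy _)).seq
    (hrun.seq (Runs.assign 0 hans)))).mono ?_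
  have k1 : (argX Q).cost ≤ 3 := by cases Q <;> simp [argX, Expr.cost]
  have k2 : (argY Q).cost ≤ 3 := by cases Q <;> simp [argY, Expr.cost]
  have k3 : (answer Q).cost ≤ 20 := by cases Q <;> simp [answer, Expr.cost, cell]
  omega

end Index

/-! ### The parameters -/

/-- The number of bits of a digit. -/
def digitBits (n : ℕ) : ℕ := Nat.log 2 (Nat.log 2 n) / 4 + 1

/-- The number of bits of a relative count. -/
def countBits (n : ℕ) : ℕ := Nat.log 2 (Nat.log 2 n) + digitBits n + 4

/-- The number of digits that fit into half of the bits of `n`. -/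
def digitsPerWord (n : ℕ) : ℕ := Nat.log 2 n / (2 * digitBits n) + 1

/-- The number of relative counts that fit into half of the bits of `n`. -/
def countsPerWord (n : ℕ) : ℕ := Nat.log 2 n / (2 * countBits n) + 1

/-- A number of digits that suffices for `2 * (d + 2)`. -/
def digitsFor (n d : ℕ) : ℕ := (Nat.log 2 (d + 2) + 2) / digitBits n + 1

/-- The scale of the distance `d`. -/
def scaleOf (n d : ℕ) : ℕ := Nat.log 2 (digitsFor n d) + 1

/-- The number of digits at the scale `j`. -/
def scaleDepth (n j : ℕ) : ℕ := min (2 ^ j) (digitsFor n n)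

/-- Half of the number of rows of a block at the scale `j`. -/
def scaleBlock (n j : ℕ) : ℕ := min ((2 ^ digitBits n) ^ scaleDepth n j / 2) (n + 2)

section bounds

variable {n : ℕ}

theorem succ_sq_le_two_pow (h : ℕ) : (h + 1) ^ 2 ≤ 4 * 2 ^ h := by
  induction h with
  | zero => simp
  | succ h ih =>
    -- The inductive step uses `(h + 2) ^ 2 ≤ 2 * (h + 1) ^ 2`, true from `h = 2` on.
    rcases Nat.lt_or_ge h 2 with h2 | h2
    · interval_cases h <;> simp
    · rw [pow_succ 2 h]; nlinarith

/-- Essentially `√n * (log n) ^ 2 = O(n)`: the unused half of the bits of `n` absorbs the squared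
logarithm. This leaves room for the table and the packed words. -/
theorem two_pow_half_mul_le (hn : 3 ≤ n) :
    2 ^ (Nat.log 2 n / 2 + 2 * Nat.log 2 (Nat.log 2 n)) ≤ 16 * n := by
  have hn' : 2 ^ Nat.log 2 n ≤ n := Nat.pow_log_le_self 2 (by omega)
  have hL0 : Nat.log 2 n ≠ 0 := (Nat.log_pos (by omega) (by omega)).ne'
  generalize Nat.log 2 n = L at *
  have hl : 2 ^ Nat.log 2 L ≤ L := Nat.pow_log_le_self 2 hL0
  have h1 := succ_sq_le_two_pow (L - L / 2)
  have h2 : L ^ 2 ≤ 4 * ((L - L / 2) + 1) ^ 2 := by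
    rw [show 4 * ((L - L / 2) + 1) ^ 2 = (2 * ((L - L / 2) + 1)) ^ 2 by ring]
    exact Nat.pow_le_pow_left (by omega) 2
  have h3 : 2 ^ (2 * Nat.log 2 L) ≤ L ^ 2 := by
    rw [mul_comm, pow_mul]; exact Nat.pow_le_pow_left hl 2
  have h4 : 2 ^ (L / 2) * 2 ^ (L - L / 2) = 2 ^ L := by rw [← pow_add]; congr 1; omega
  calc 2 ^ (L / 2 + 2 * Nat.log 2 L) = 2 ^ (L / 2) * 2 ^ (2 * Nat.log 2 L) := pow_add ..
    _ ≤ 2 ^ (L / 2) * (16 * 2 ^ (L - L / 2)) := Nat.mul_le_mul_left _ (by omega)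
    _ = 16 * 2 ^ L := by rw [← h4]; ring
    _ ≤ 16 * n := by omega

theorem log_two_lt (n : ℕ) : Nat.log 2 n < 2 ^ (Nat.log 2 (Nat.log 2 n) + 1) :=
  Nat.lt_pow_succ_log_self (by omega) _

theorem digitsPerWord_mul_le (n : ℕ) :
    digitsPerWord n * (2 ^ digitBits n + 1) ≤
      2 ^ (Nat.log 2 (Nat.log 2 n) + digitBits n + 2) := by
  have h1 : digitsPerWord n ≤ 2 ^ (Nat.log 2 (Nat.log 2 n) + 1) :=
    (Nat.succ_le_succ (Nat.div_le_self _ _)).trans (log_two_lt n)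
  have h2 : 2 ^ digitBits n + 1 ≤ 2 ^ (digitBits n + 1) := by
    rw [pow_succ]; have := Nat.one_le_two_pow (n := digitBits n); omega
  refine (Nat.mul_le_mul h1 h2).trans (le_of_eq ?_)
  rw [← pow_add]; congr 1; omega

theorem table_le (hn : 3 ≤ n) :
    (2 ^ digitBits n) ^ digitsPerWord n * digitsPerWord n * (2 ^ digitBits n + 1) ≤ 256 * n := by
  have h1 := two_pow_half_mul_le hn
  have h2 : (2 ^ digitBits n) ^ digitsPerWord n ≤ 2 ^ (Nat.log 2 n / 2 + digitBits n) := by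
    rw [← pow_mul]
    refine Nat.pow_le_pow_right (by omega) ?_
    rw [digitsPerWord, mul_add, mul_one, ← Nat.div_div_eq_div_mul]
    exact Nat.add_le_add_right (Nat.mul_div_le _ _) _
  rw [mul_assoc]
  refine (Nat.mul_le_mul h2 (digitsPerWord_mul_le n)).trans ?_
  rw [← pow_add]
  calc _ ≤ 2 ^ (4 + (Nat.log 2 n / 2 + 2 * Nat.log 2 (Nat.log 2 n))) := by
        refine Nat.pow_le_pow_right (by omega) ?_
        unfold digitBits; omega
    _ ≤ 256 * n := by rw [pow_add]; omega

theorem counts_pow_le (hn : 3 ≤ n) : (2 ^ countBits n) ^ countsPerWord n ≤ 512 * n := by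
  have h1 := two_pow_half_mul_le hn
  rw [← pow_mul]
  calc _ ≤ 2 ^ (5 + (Nat.log 2 n / 2 + 2 * Nat.log 2 (Nat.log 2 n))) := by
        refine Nat.pow_le_pow_right (by omega) ?_
        rw [countsPerWord, mul_add, mul_one, ← Nat.div_div_eq_div_mul]
        have := Nat.mul_div_le (Nat.log 2 n / 2) (countBits n)
        have : countBits n ≤ 2 * Nat.log 2 (Nat.log 2 n) + 5 := by
          unfold countBits digitBits; omega
        omega
    _ ≤ 512 * n := by rw [pow_add]; omega

/-- Both the base and `countBits n` are `O(2 ^ (l / 4))` with `l = log log n`, so their product is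
`O(log n)`. Hence the `f + 1` relative counts at one position fill only a constant number of words.
-/
theorem base_succ_le (hn : 3 ≤ n) : 2 ^ digitBits n + 1 ≤ 64 * countsPerWord n := by
  have hL0 : Nat.log 2 n ≠ 0 := (Nat.log_pos (by omega) (by omega)).ne'
  have hb : 0 < 2 * countBits n := by unfold countBits; omega
  have h1 : Nat.log 2 n < 2 * countBits n * countsPerWord n := by
    rw [countsPerWord, mul_add, mul_one, mul_comm]
    exact Nat.lt_div_mul_add hb
  have h2 : 2 ^ Nat.log 2 (Nat.log 2 n) ≤ Nat.log 2 n := Nat.pow_log_le_self 2 hL0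
  have h3 : 2 * countBits n ≤ 16 * 2 ^ (Nat.log 2 (Nat.log 2 n) / 4) := by
    have : Nat.log 2 (Nat.log 2 n) / 4 < 2 ^ (Nat.log 2 (Nat.log 2 n) / 4) :=
      Nat.lt_two_pow_self
    unfold countBits digitBits; omega
  have h4 : 2 ^ (Nat.log 2 (Nat.log 2 n) / 4) * 2 ^ (Nat.log 2 (Nat.log 2 n) / 4) ≤
      2 ^ Nat.log 2 (Nat.log 2 n) := by
    rw [← pow_add]; exact Nat.pow_le_pow_right (by omega) (by omega)
  have h5 : 2 ^ digitBits n + 1 ≤ 4 * 2 ^ (Nat.log 2 (Nat.log 2 n) / 4) := by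
    have := Nat.one_le_two_pow (n := Nat.log 2 (Nat.log 2 n) / 4)
    rw [digitBits, pow_succ]; omega
  have h6 : (2 * countBits n) * (2 ^ digitBits n + 1) ≤
      (2 * countBits n) * (64 * countsPerWord n) := by
    calc _ ≤ (16 * 2 ^ (Nat.log 2 (Nat.log 2 n) / 4)) *
          (4 * 2 ^ (Nat.log 2 (Nat.log 2 n) / 4)) := Nat.mul_le_mul h3 h5
      _ = 64 * (2 ^ (Nat.log 2 (Nat.log 2 n) / 4) * 2 ^ (Nat.log 2 (Nat.log 2 n) / 4)) := by ring
      _ ≤ 64 * (2 * countBits n * countsPerWord n) := by omega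
      _ = _ := by ring
  exact Nat.le_of_mul_le_mul_left h6 hb

theorem countsPerWord_le (n : ℕ) : countsPerWord n ≤ digitsPerWord n := by
  refine Nat.succ_le_succ (Nat.div_le_div_left ?_ (by unfold digitBits; omega))
  unfold countBits; omega

theorem log_add_two_le (hn : 3 ≤ n) : Nat.log 2 (n + 2) ≤ Nat.log 2 n + 1 := by
  rw [← Nat.log_mul_base (by omega) (by omega)]
  exact Nat.log_mono_right (by omega)

/-- The maximal depth is of the order of the number of digits per word, so that many sequences,
packed, take linear space. -/
theorem digitsFor_le (hn : 3 ≤ n) : digitsFor n n ≤ 5 * digitsPerWord n := by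
  have hb : 0 < digitBits n := Nat.succ_pos _
  have h1 := log_add_two_le hn
  have h2 : Nat.log 2 n < 2 * digitBits n * digitsPerWord n := by
    rw [digitsPerWord, mul_add, mul_one, mul_comm]
    exact Nat.lt_div_mul_add (by omega)
  have h3 : 1 ≤ digitsPerWord n := Nat.succ_pos _
  refine Nat.succ_le_of_lt ((Nat.div_lt_iff_lt_mul hb).2 ?_)
  have : digitBits n * 1 ≤ digitBits n * digitsPerWord n := Nat.mul_le_mul_left _ h3
  nlinarith

theorem digitsPerWord_le (hn : 3 ≤ n) : digitsPerWord n ≤ n := by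
  have := Nat.log_lt_self 2 (show n ≠ 0 by omega)
  exact (Nat.succ_le_succ (Nat.div_le_self _ _)).trans this

theorem digitsFor_mono (n : ℕ) {d e : ℕ} (h : d ≤ e) : digitsFor n d ≤ digitsFor n e :=
  Nat.succ_le_succ (Nat.div_le_div_right
    (Nat.add_le_add_right (Nat.log_mono_right (Nat.add_le_add_right h 2)) 2))

theorem lt_base_pow_digitsFor (n d : ℕ) :
    2 * (d + 2) ≤ (2 ^ digitBits n) ^ digitsFor n d := by
  have hb : 0 < digitBits n := Nat.succ_pos _
  have h1 : d + 2 < 2 ^ (Nat.log 2 (d + 2) + 1) := Nat.lt_pow_succ_log_self (by omega) _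
  rw [← pow_mul]
  calc 2 * (d + 2) ≤ 2 ^ (Nat.log 2 (d + 2) + 2) := by rw [pow_succ]; omega
    _ ≤ _ := by
      refine Nat.pow_le_pow_right (by omega) ?_
      rw [digitsFor, mul_add, mul_one, mul_comm]
      exact (Nat.lt_div_mul_add hb).le

/-- Only the weight of the leading digit is stored, never `f ^ depth`; dropping one factor `f` makes
it linear in `n`. -/
theorem base_pow_pred_le (n : ℕ) : (2 ^ digitBits n) ^ (digitsFor n n - 1) ≤ 4 * (n + 2) := by
  rw [← pow_mul, digitsFor, Nat.add_sub_cancel]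
  calc _ ≤ 2 ^ (Nat.log 2 (n + 2) + 2) :=
        Nat.pow_le_pow_right (by omega) (Nat.mul_div_le _ _)
    _ ≤ _ := by
      have := Nat.pow_log_le_self 2 (show n + 2 ≠ 0 by omega)
      rw [pow_add]; omega

theorem two_pow_scaleOf_le (n d : ℕ) : 2 ^ scaleOf n d ≤ 2 * digitsFor n d := by
  have := Nat.pow_log_le_self 2 (show digitsFor n d ≠ 0 from Nat.succ_ne_zero _)
  rw [scaleOf, pow_succ]; omega

theorem le_scaleDepth {d : ℕ} (hd : d ≤ n) : digitsFor n d ≤ scaleDepth n (scaleOf n d) :=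
  le_min (Nat.lt_pow_succ_log_self (by omega) _).le (digitsFor_mono n hd)

theorem scaleDepth_le_two_mul (n d : ℕ) : scaleDepth n (scaleOf n d) ≤ 2 * digitsFor n d :=
  (min_le_left _ _).trans (two_pow_scaleOf_le n d)

/-- From `log log n ≤ 4 * digitBits n` and `Nat.log 2 d ≤ 2 * log d` the bound is `8 * R + 5`, where
`R` is the quotient of logarithms; `n ≥ 3 > e` makes its denominator positive. -/
theorem digitsFor_le_log {n d : ℕ} (hn : 3 ≤ n) :
    (digitsFor n d : ℝ) ≤ 10 * (1 + Real.log d / Real.log (Real.log n)) := by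
  have hb : (0 : ℝ) < digitBits n := by exact_mod_cast Nat.succ_pos _
  have hb1 : (1 : ℝ) ≤ digitBits n := by exact_mod_cast Nat.succ_pos _
  have hn3 : (3 : ℝ) ≤ n := by exact_mod_cast hn
  have hlog : 1 < Real.log n := by
    rw [Real.lt_log_iff_exp_lt (by linarith)]
    linarith [Real.exp_one_lt_d9]
  have hll : 0 < Real.log (Real.log n) := Real.log_pos hlog
  have hlog2 := Real.log_two_lt_d9
  have hlog2' := Real.log_two_gt_d9
  have hbound : Real.log (Real.log n) ≤ 4 * digitBits n := by
    have h1 : (n : ℝ) ≤ 2 ^ (Nat.log 2 n + 1) := by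
      exact_mod_cast (Nat.lt_pow_succ_log_self (by omega) n).le
    have h2 : Real.log n ≤ 2 ^ (Nat.log 2 (Nat.log 2 n) + 1) := by
      have h3 := Real.log_le_log (by linarith) h1
      rw [Real.log_pow] at h3
      have h4 : ((Nat.log 2 n + 1 : ℕ) : ℝ) ≤ 2 ^ (Nat.log 2 (Nat.log 2 n) + 1) := by
        exact_mod_cast log_two_lt n
      have h5 : (0 : ℝ) ≤ ((Nat.log 2 n + 1 : ℕ) : ℝ) := Nat.cast_nonneg _
      nlinarith
    have h3 := Real.log_le_log (by linarith) h2
    rw [Real.log_pow] at h3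
    have h4 : ((Nat.log 2 (Nat.log 2 n) + 1 : ℕ) : ℝ) ≤ 4 * digitBits n := by
      have : Nat.log 2 (Nat.log 2 n) + 1 ≤ 4 * digitBits n := by unfold digitBits; omega
      exact_mod_cast this
    have h5 : (0 : ℝ) ≤ ((Nat.log 2 (Nat.log 2 n) + 1 : ℕ) : ℝ) := Nat.cast_nonneg _
    nlinarith
  have hd0 : 0 ≤ Real.log d := Real.log_natCast_nonneg d
  have hlogd : (Nat.log 2 d : ℝ) ≤ 2 * Real.log d := by
    rcases Nat.eq_zero_or_pos d with rfl | hd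
    · simp
    · have h1 : ((2 : ℝ) ^ Nat.log 2 d) ≤ d := by
        exact_mod_cast Nat.pow_log_le_self 2 hd.ne'
      have h2 := Real.log_le_log (by positivity) h1
      rw [Real.log_pow] at h2
      have h3 : (0 : ℝ) ≤ (Nat.log 2 d : ℝ) := Nat.cast_nonneg _
      nlinarith
  -- For `d > 0` this is `d + 2 ≤ 4 * d`; for `d = 0` the logarithm on the right is read as `0`.
  have hd2 : Nat.log 2 (d + 2) ≤ Nat.log 2 d + 2 := by
    rcases Nat.eq_zero_or_pos d with rfl | hd
    · rw [Nat.log_eq_one_iff.2 (by omega)]; omega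
    · rw [show Nat.log 2 d + 2 = Nat.log 2 d + 1 + 1 from rfl,
        ← Nat.log_mul_base (by omega) hd.ne', ← Nat.log_mul_base (by omega) (by omega)]
      exact Nat.log_mono_right (by omega)
  have hcast : (digitsFor n d : ℝ) ≤ (Nat.log 2 d + 4) / digitBits n + 1 := by
    have h1 : ((digitsFor n d : ℕ) : ℝ) =
        (((Nat.log 2 (d + 2) + 2) / digitBits n : ℕ) : ℝ) + 1 := by
      rw [digitsFor]; push_cast; rfl
    rw [h1]
    have h2 : (((Nat.log 2 (d + 2) + 2) / digitBits n : ℕ) : ℝ) ≤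
        ((Nat.log 2 (d + 2) + 2 : ℕ) : ℝ) / digitBits n := Nat.cast_div_le
    have h3 : ((Nat.log 2 (d + 2) + 2 : ℕ) : ℝ) ≤ Nat.log 2 d + 4 := by
      exact_mod_cast Nat.add_le_add_right hd2 2
    have h4 := div_le_div_of_nonneg_right h3 hb.le
    linarith
  have h1 : Real.log d / digitBits n ≤ 4 * (Real.log d / Real.log (Real.log n)) := by
    rw [mul_div_assoc', div_le_div_iff₀ hb hll]
    nlinarith
  have h2 : ((Nat.log 2 d : ℝ) + 4) / digitBits n ≤ 2 * (Real.log d / digitBits n) + 4 := by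
    rw [mul_div_assoc', div_add' _ _ _ hb.ne', div_le_div_iff_of_pos_right hb]
    linarith
  have h3 : 0 ≤ Real.log d / Real.log (Real.log n) := by positivity
  linarith

end bounds

/-! ### The data structure -/

/-- The successive lists of the radix sort of a list of `k`-digit numbers in base `f`. -/
def radixLevel (f k : ℕ) (Q : List ℕ) : ℕ → List ℕ
  | 0 => Q
  | i + 1 => radixStep f (f ^ (k - 1 - i)) (radixLevel f k Q i)

theorem lt_of_mem_radixLevel {f k : ℕ} (hf : 0 < f) {Q : List ℕ} (hQ : ∀ q ∈ Q, q < f ^ k) :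
    ∀ i, ∀ q ∈ radixLevel f k Q i, q < f ^ (k - i)
  | 0 => hQ
  | i + 1 => fun q hq => by
    rw [show k - (i + 1) = k - 1 - i by omega]
    exact lt_of_mem_radixStep (pow_pos hf _) hq

/-- The rows of points at the scale `j` with the parity `π`, as numbers. -/
def scaleKeys (n : ℕ) (L : List (ℕ × ℕ)) (j π : ℕ) : List ℕ :=
  L.map (blockKey (scaleBlock n j) π ((2 ^ digitBits n) ^ scaleDepth n j))

/-- The digit sequence number `2 * (2 ^ j + i) + π` belongs to the `i`-th digit at the scale `j` with
the parity `π`. -/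
def scaleDigit (n : ℕ) (L : List (ℕ × ℕ)) (t p : ℕ) : ℕ :=
  let j := Nat.log 2 (t / 2)
  let i := t / 2 - 2 ^ j
  (radixLevel (2 ^ digitBits n) (scaleDepth n j) (scaleKeys n L j (t % 2)) i).getD p 0 /
    (2 ^ digitBits n) ^ (scaleDepth n j - 1 - i) % 2 ^ digitBits n

/-- The dominance counting structure for the points `L` in the `n × n` grid. -/
def dominanceIndex (n : ℕ) (L : List (ℕ × ℕ)) : Index where
  N := L.length
  f := 2 ^ digitBits n
  s := digitsPerWord n
  g := countsPerWord n
  V := 2 ^ countBits n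
  dig := scaleDigit n L
  pos i := L.countP (·.2 < i)
  cx i := L.countP (·.1 ≤ i)
  bk d := scaleBlock n (scaleOf n d)
  start d := 2 * 2 ^ scaleOf n d
  depth d := scaleDepth n (scaleOf n d)
  pw d := (2 ^ digitBits n) ^ scaleDepth n (scaleOf n d) / 2 ^ digitBits n

/-- As `i < 2 ^ j`, half the sequence number lies in `[2 ^ j, 2 ^ (j + 1))`, so its binary logarithm
recovers the scale and its parity bit `π` stays free. -/
theorem codes_scaleDigit (n : ℕ) (L : List (ℕ × ℕ)) {T j π : ℕ} (hπ : π < 2)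
    (hT : 4 * 2 ^ j ≤ T) (m : ℕ) : ∀ i, i + m = scaleDepth n j →
    (dominanceIndex n L).Codes T m (2 * (2 ^ j + i) + π)
      (radixLevel (2 ^ digitBits n) (scaleDepth n j) (scaleKeys n L j π) i) := by
  induction m with
  | zero => intro i _; trivial
  | succ m ih =>
    intro i hi
    have hij : i < 2 ^ j := by
      have : scaleDepth n j ≤ 2 ^ j := min_le_left _ _
      omega
    have hm : scaleDepth n j - 1 - i = m := by omega
    refine ⟨by omega, fun p hp => ?_, ?_⟩
    · have ht : (2 * (2 ^ j + i) + π) / 2 = 2 ^ j + i := by omega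
      have ht' : (2 * (2 ^ j + i) + π) % 2 = π := by omega
      have hlog : Nat.log 2 (2 ^ j + i) = j :=
        Nat.log_eq_of_pow_le_of_lt_pow (by omega) (by rw [pow_succ]; omega)
      change scaleDigit n L _ p = _
      simp only [scaleDigit, ht, ht', hlog, Nat.add_sub_cancel_left, hm]
      rw [List.getD_eq_getElem _ _ hp]
      -- The reduction modulo the base in `scaleDigit` matters only for unused sequence numbers,
      -- where it still guarantees `dig_lt`.
      refine Nat.mod_eq_of_lt ((Nat.div_lt_iff_lt_mul (by positivity)).2 ?_)
      have h := lt_of_mem_radixLevel (k := scaleDepth n j) (Q := scaleKeys n L j π)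
        (f := 2 ^ digitBits n) (by positivity) (fun q hq => ?_) i _ (List.getElem_mem hp)
      · rwa [show scaleDepth n j - i = m + 1 by omega, pow_succ, mul_comm] at h
      · simp only [scaleKeys, List.mem_map] at hq
        obtain ⟨r, _, rfl⟩ := hq
        have : 0 < (2 ^ digitBits n) ^ scaleDepth n j := by positivity
        rw [blockKey]; omega
    · have h := ih (i + 1) (by omega)
      rwa [radixLevel, hm, show 2 * (2 ^ j + (i + 1)) + π = 2 * (2 ^ j + i) + π + 2 by ring] at h

theorem dominanceIndex_fits {n w c : ℕ} {L : List (ℕ × ℕ)} (hn : 3 ≤ n)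
    (hw : 32 * (10240 * (c + 1) * n) ≤ 2 ^ w) (hL : L.length ≤ c * n) :
    (dominanceIndex n L).Fits w (10240 * (c + 1) * n) (8 * digitsFor n n) := by
  have hZ : 10240 * (c + 1) * n = 10240 * (c * n) + 10240 * n := by ring
  have hs : 0 < digitsPerWord n := Nat.succ_pos _
  have hg : 0 < countsPerWord n := Nat.succ_pos _
  have hT : 8 * digitsFor n n ≤ 40 * digitsPerWord n := by have := digitsFor_le hn; omega
  have hsn := digitsPerWord_le hn
  have hdiv : digitsPerWord n * (L.length / digitsPerWord n + 1) ≤ c * n + n := by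
    have := Nat.mul_div_le L.length (digitsPerWord n)
    rw [mul_add]; omega
  have htab := table_le hn
  have hchunk : 8 * digitsFor n n * (L.length / digitsPerWord n + 1) ≤ 40 * (c * n + n) := by
    calc _ ≤ 40 * digitsPerWord n * (L.length / digitsPerWord n + 1) := Nat.mul_le_mul_right _ hT
      _ = 40 * (digitsPerWord n * (L.length / digitsPerWord n + 1)) := by ring
      _ ≤ _ := Nat.mul_le_mul_left _ hdiv
  have hbase := base_succ_le hn
  exact
    { addr := hw
      ten_le := by omega
      f_pos := Nat.two_pow_pos _
      s_pos := hs
      g_pos := hg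
      T_pos := Nat.mul_pos (by omega) (Nat.succ_pos _)
      lt_V := (digitsPerWord_mul_le n).trans_lt
        (Nat.pow_lt_pow_right (by omega) (by unfold countBits; omega))
      dig_lt := fun t i => Nat.mod_lt _ (Nat.two_pow_pos _)
      N_le := by change L.length ≤ _; omega
      table_le := htab.trans (by omega)
      pow_le := (counts_pow_le hn).trans (by omega)
      chunk_le := by
        change 8 * digitsFor n n * (L.length / digitsPerWord n + 1) ≤ _
        omega
      cells_le := by
        change (L.length / digitsPerWord n + 1) * (2 ^ digitBits n + 1) ≤ _
        calc _ ≤ (L.length / digitsPerWord n + 1) * (64 * digitsPerWord n) :=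
              Nat.mul_le_mul_left _ (hbase.trans (Nat.mul_le_mul_left _ (countsPerWord_le n)))
          _ = 64 * (digitsPerWord n * (L.length / digitsPerWord n + 1)) := by ring
          _ ≤ _ := by omega
      rel_le := by
        change 8 * digitsFor n n * ((L.length / digitsPerWord n + 1) * (2 ^ digitBits n + 1) /
          countsPerWord n + 1) ≤ _
        have h1 : (L.length / digitsPerWord n + 1) * (2 ^ digitBits n + 1) / countsPerWord n ≤
            64 * (L.length / digitsPerWord n + 1) := by
          refine Nat.div_le_of_le_mul ?_
          calc _ ≤ (L.length / digitsPerWord n + 1) * (64 * countsPerWord n) :=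
                Nat.mul_le_mul_left _ hbase
            _ = _ := by ring
        calc _ ≤ 8 * digitsFor n n * (65 * (L.length / digitsPerWord n + 1)) :=
              Nat.mul_le_mul_left _ (by
                generalize L.length / digitsPerWord n = q at h1 ⊢
                omega)
          _ = 65 * (8 * digitsFor n n * (L.length / digitsPerWord n + 1)) := by ring
          _ ≤ _ := by omega
      abs_le := by
        change 8 * digitsFor n n * ((L.length / (digitsPerWord n * (2 ^ digitBits n + 1)) + 1) *
          (2 ^ digitBits n + 1)) ≤ _
        -- This crude bound, times the `40` from the number of sequences, gives the constant `10240`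
        -- in the array length.
        have h1 : digitsPerWord n * (2 ^ digitBits n + 1) ≤ 256 * n := by
          refine le_trans ?_ htab
          rw [mul_assoc]
          exact Nat.le_mul_of_pos_left _ (by positivity)
        have h2 := Nat.mul_div_le L.length (digitsPerWord n * (2 ^ digitBits n + 1))
        generalize hS : digitsPerWord n * (2 ^ digitBits n + 1) = B at h1 h2 ⊢
        calc _ ≤ 40 * digitsPerWord n * ((L.length / B + 1) * (2 ^ digitBits n + 1)) :=
              Nat.mul_le_mul_right _ hT
          _ = 40 * (B * (L.length / B) + B) := by rw [← hS]; ring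
          _ ≤ _ := by omega }

theorem dominanceIndex_represents {n c : ℕ} {S : Finset (ℕ × ℕ)} {L : List (ℕ × ℕ)} (hn : 3 ≤ n)
    (hperm : L.Perm S.toList) (hsort : L.Pairwise fun p q => p.2 ≤ q.2) :
    (dominanceIndex n L).Represents S L n (10240 * (c + 1) * n) (8 * digitsFor n n) := by
  have hZ : 10240 * (c + 1) * n = 10240 * (c * n) + 10240 * n := by ring
  have hmax : digitsFor n n ≤ 5 * n := by
    have := digitsFor_le hn
    have := digitsPerWord_le hn
    omega
  -- The sequences at scale `j` have numbers below `4 * 2 ^ j`, and rounding a depth up to a power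
  -- of two at most doubles it; hence `8`.
  have hscale (d : ℕ) (hd : d ≤ n) : 4 * 2 ^ scaleOf n d ≤ 8 * digitsFor n n := by
    have := two_pow_scaleOf_le n d
    have := digitsFor_mono n hd
    omega
  have hpos (d : ℕ) (hd : d ≤ n) : 1 ≤ scaleDepth n (scaleOf n d) :=
    le_trans (Nat.succ_le_of_lt (Nat.succ_pos _)) (le_scaleDepth hd)
  exact
    { perm := hperm
      sorted := hsort
      N_eq := rfl
      pos_eq := fun _ => rfl
      cx_eq := fun _ => rfl
      n_lt := by omega
      lt_bk := fun d hd => by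
        have h1 := lt_base_pow_digitsFor n d
        have h2 : (2 ^ digitBits n) ^ digitsFor n d ≤
            (2 ^ digitBits n) ^ scaleDepth n (scaleOf n d) :=
          Nat.pow_le_pow_right (Nat.two_pow_pos _) (le_scaleDepth hd)
        -- The cap `n + 2` on the block size still exceeds `d + 1`, as `d ≤ n`.
        change d + 1 < min _ _
        omega
      bk_le := fun d hd => by
        change min _ _ ≤ _
        omega
      two_bk_le := fun d hd => by
        change 2 * min _ _ ≤ (2 ^ digitBits n) ^ scaleDepth n (scaleOf n d)
        omega
      start_le := fun d hd => by
        have := hscale d hd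
        change 2 * 2 ^ scaleOf n d ≤ _
        omega
      depth_le := fun d hd => by
        change min _ _ ≤ _
        omega
      pw_eq := fun d hd => rfl
      pw_le := fun d hd => by
        have h1 := base_pow_pred_le n
        have h2 : (2 ^ digitBits n) ^ (scaleDepth n (scaleOf n d) - 1) ≤
            (2 ^ digitBits n) ^ (digitsFor n n - 1) :=
          Nat.pow_le_pow_right (Nat.two_pow_pos _) (Nat.sub_le_sub_right (min_le_right _ _) 1)
        change (2 ^ digitBits n) ^ scaleDepth n (scaleOf n d) / 2 ^ digitBits n ≤ _
        rw [← Nat.sub_add_cancel (hpos d hd), pow_succ, Nat.mul_div_cancel _ (Nat.two_pow_pos _)]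
        omega
      codes := fun d hd π hπ =>
        codes_scaleDigit n L hπ (hscale d hd) (scaleDepth n (scaleOf n d)) 0 (by omega) }

/-- For every constant `c` there are query programs, one for each kind of quadrant, and constants
`A`, `B` such that every set of at most `c * n` points below the diagonal of the `n × n` grid has a
data structure of at most `A * n` words, for every word size that can address `A * n` cells, on
which every query at a grid point `(x, y)`, `d = |x - y|`, is answered in register `0` in time at
most `B * (1 + log d / log log n)`, leaving the data structure unchanged. -/
theorem mainTheorem9 (c : ℕ) :
    ∃ (query : Quadrant → WordRAM.Prog) (A B : ℕ),
      ∀ (n w : ℕ) (S : Finset (ℕ × ℕ)),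
        3 ≤ n → A * n ≤ 2 ^ w → BelowDiagonal n S → S.card ≤ c * n →
        ∃ mem : List (BitVec w), mem.length ≤ A * n ∧
          ∀ (Q : Quadrant) (x y : ℕ), x ∈ Finset.Icc 1 n → y ∈ Finset.Icc 1 n →
            ∃ (t : ℕ) (final : WordRAM.State w),
              WordRAM.Exec (query Q) (WordRAM.queryState mem x y) t final ∧
              (t : ℝ) ≤ B * (1 + Real.log (Nat.dist x y : ℝ) / Real.log (Real.log (n : ℝ))) ∧
              (final.reg 0).toNat = dominanceCount S x y Q ∧
              final.mem = mem := by
  -- The memory has `16 * Z` words and addressing asks for `32 * Z ≤ 2 ^ w`; one `A` serves both.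
  -- The `20` in `B` is `2` for rounding the depth times `10` from `digitsFor_le_log`.
  refine ⟨Index.queryProg, 32 * (10240 * (c + 1)), 60 + Index.setupProg.straightCost +
    20 * (2 + Index.bodyProg.straightCost), fun n w S hn hw hS hcard => ?_⟩
  have hw' : 32 * (10240 * (c + 1) * n) ≤ 2 ^ w := by rwa [← mul_assoc]
  obtain ⟨L, hperm, hsort⟩ : ∃ L : List (ℕ × ℕ), L.Perm S.toList ∧
      L.Pairwise fun p q => p.2 ≤ q.2 := by
    refine ⟨S.toList.mergeSort fun p q => p.2 ≤ q.2, List.mergeSort_perm _ _, ?_⟩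
    have := List.pairwise_mergeSort (le := fun p q : ℕ × ℕ => decide (p.2 ≤ q.2))
      (by simp only [decide_eq_true_eq]; intros; omega)
      (by simp only [Bool.or_eq_true, decide_eq_true_eq]; intros; omega) S.toList
    simpa using this
  have hlen : L.length ≤ c * n := by rw [hperm.length_eq, Finset.length_toList]; exact hcard
  have hfits := dominanceIndex_fits hn hw' hlen
  have hrep := dominanceIndex_represents (c := c) hn hperm hsort
  refine ⟨WordRAM.interleave w (10240 * (c + 1) * n) (dominanceIndex n L).region, ?_,
    fun Q x y hx hy => ?_⟩
  · rw [WordRAM.length_interleave, mul_assoc 32]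
    omega
  rw [Finset.mem_Icc] at hx hy
  have hnZ : n < 2 ^ w := by have := hrep.n_lt; omega
  obtain ⟨d, hd, ρ', hrun, hans⟩ := hrep.runs_query hfits hS Q
    (ρ := fun r => if r = 0 then x else if r = 1 then y else 0) (x := x) (y := y)
    rfl rfl rfl hx.1 hx.2 hy.2
  obtain ⟨t, final, hexec, ht, hfinal⟩ := hrun (WordRAM.queryState _ x y) ⟨rfl, fun r => by
    simp only [WordRAM.queryState]
    split_ifs
    · simp [Nat.mod_eq_of_lt (hx.2.trans_lt hnZ)]
    · simp [Nat.mod_eq_of_lt (hy.2.trans_lt hnZ)]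
    · simp⟩
  refine ⟨t, final, hexec, ?_, (hfinal.2 0).trans hans, hfinal.1⟩
  have hdepth : (dominanceIndex n L).depth d ≤ 2 * digitsFor n (Nat.dist x y) :=
    (scaleDepth_le_two_mul n d).trans (Nat.mul_le_mul_left _ (digitsFor_mono n (by
      rw [Nat.dist]; omega)))
  have hlog := digitsFor_le_log (d := Nat.dist x y) hn
  have hratio : 0 ≤ Real.log (Nat.dist x y : ℝ) / Real.log (Real.log (n : ℝ)) := by
    refine div_nonneg (Real.log_natCast_nonneg _) (Real.log_nonneg ?_)
    have hn3 : (3 : ℝ) ≤ n := by exact_mod_cast hn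
    rw [Real.le_log_iff_exp_le (by linarith)]
    linarith [Real.exp_one_lt_d9]
  generalize Real.log (Nat.dist x y : ℝ) / Real.log (Real.log (n : ℝ)) = R at hlog hratio ⊢
  generalize Index.setupProg.straightCost = a at ht ⊢
  generalize Index.bodyProg.straightCost = b at ht ⊢
  have ht' : t ≤ 60 + a + 2 * digitsFor n (Nat.dist x y) * (2 + b) :=
    ht.trans (Nat.add_le_add_left (Nat.mul_le_mul_right _ hdepth) _)
  have ht'' : (t : ℝ) ≤ 60 + a + 2 * digitsFor n (Nat.dist x y) * (2 + b) := by exact_mod_cast ht'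
  push_cast
  have ha : (0 : ℝ) ≤ a := Nat.cast_nonneg a
  have hb : (0 : ℝ) ≤ b := Nat.cast_nonneg b
  have h1 := mul_le_mul_of_nonneg_right hlog (show (0 : ℝ) ≤ 2 + b by linarith)
  have h2 := mul_nonneg ha hratio
  linarith
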